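/- **Setting.** Let $\nu,\mu$ be mutually absolutely continuous Borel probability measures on $\mathbb R$, $\lambda=\log\frac{d\mu}{d\nu}$, $M_0(w)=\int e^{w\lambda}\,d\nu$, $M_1(w)=\int e^{w\lambda}\,d\mu$, $D(1\|0)=\int\lambda\,d\mu$, $D(0\|1)=-\int\lambda\,d\nu$. Assume that $0$ is an interior point of $\{w:M_0(w)<\infty\}$ and of $\{w:M_1(w)<\infty\}$, and that $0<D(1\|0),D(0\|1)<\infty$. Put $D_{\min}=\min\{D(0\|1),D(1\|0)\}$, $I_j(x)=\sup_{w\in\mathbb R}\{xw-\log M_j(w)\}$ $(j=0,1)$, $C=I_0(0)$, $I_0^{-1}(z)=\max\{x:I_0(x)=z\}$ and $I_1^{-1}(z)=\min\{x:I_1(x)=z\}$. Let $0\le n\le m$ be integers. Given the state $\theta\in\{0,1\}$, the measurements $y_i(k)$ $(1\le i\le m,\ k\ge1)$ are i.i.d. with law $\nu$ if $\theta=0$ and $\mu$ if $\theta=1$. A detection rule $f=(f_1,f_2,\dots)$ is a sequence of measurable maps $f_k:\mathbb R^{mk}\to[0,1]$; $f_k$ is the probability of deciding $1$ at time $k$.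 An attack strategy $g$ chooses, for each set $\mathcal I\subseteq\{1,\dots,m\}$ with $|\mathcal I|=n$ and each $\theta$, bias vectors $\mathbf y^a(k)\in\mathbb R^m$, where $\mathbf y^a(k)$ is a (measurable, possibly randomized) function of $k$, $\theta$, $\mathcal I$, the measurements $y_i(t)$ with $i\in\mathcal I$, $t\le k$, and the earlier biases $\mathbf y^a(t)$, $t<k$; randomization is independent of all the measurements. It is admissible if, for all such $\mathcal I$ and $\theta$, $\bigcup_{k}\operatorname{supp}\mathbf y^a(k)=\mathcal I$ almost surely. The detector receives $\mathbf y'(k)=\mathbf y(k)+\mathbf y^a(k)$; write $\mathbf Y'(k)=(\mathbf y'(1),\dots,\mathbf y'(k))$. Let $e(0,\mathcal I,k)=\mathbb E_0 f_k(\mathbf Y'(k))$, $e(1,\mathcal I,k)=1-\mathbb E_1f_k(\mathbf Y'(k))$, $\epsilon(k)=\max_{\theta\in\{0,1\},\,|\mathcal I|=n}e(\theta,\mathcal I,k)$ and $$\rho(f,g)=\liminf_{k\to\infty}-\frac{\log\epsilon(k)}{k}\qquad(\log 0=-\infty).$$ The efficiency of $f$ is $E(f)=\rho(f,\mathbf 0)$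 (no bias at all), and its security is $S(f)=\inf_g\rho(f,g)$ over all admissible $g$. **Theorem.** For every detection rule $f$: 1. $E(f)\le mC$; 2. $S(f)\le (m-2n)^+C$, where $(m-2n)^+=\max\{0,m-2n\}$; 3. $S(f)\le E(f)$; 4. let $E(f)=z$. If $0<z<(m-n)D_{\min}$, then the maximum $I_0^{-1}(z/(m-n))$ and the minimum $I_1^{-1}(z/(m-n))$ exist and $$S(f)\le h(z)=(m-n)\min\left\{I_0\left(I_1^{-1}\left(\tfrac{z}{m-n}\right)\right),\,I_1\left(I_0^{-1}\left(\tfrac{z}{m-n}\right)\right)\right\};$$ if $z\ge(m-n)D_{\min}$, then $S(f)=0$. -/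

import Mathlib

open MeasureTheory ProbabilityTheory Filter

noncomputable section

namespace ByzantineDetection

/-! ### Log-likelihood ratio, divergences and rate functions

`llr μ ν` is Mathlib's log-likelihood ratio `y ↦ log (dμ/dν (y))`. -/

/-- Moment generating function `w ↦ ∫ exp (w * X) dω`, with the value `∞` where it diverges. -/
def momentGen (ω : Measure ℝ) (X : ℝ → ℝ) (w : ℝ) : ENNReal :=
  ∫⁻ y, ENNReal.ofReal (Real.exp (w * X y)) ∂ω

/-- The region where the moment generating function is finite. -/
def momentDom (ω : Measure ℝ) (X : ℝ → ℝ) : Set ℝ :=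
  {w | momentGen ω X w < ⊤}

/-- Fenchel-Legendre transform of the logarithm of the moment generating function. -/
def rateFn (ω : Measure ℝ) (X : ℝ → ℝ) (x : ℝ) : EReal :=
  ⨆ w : ℝ, (((x * w : ℝ) : EReal) - ENNReal.log (momentGen ω X w))

/-- The domain of the moment generating function of the log-likelihood ratio under `ν`. -/
def dom₀ (ν μ : Measure ℝ) : Set ℝ := momentDom ν (llr μ ν)

/-- The domain of the moment generating function of the log-likelihood ratio under `μ`. -/
def dom₁ (ν μ : Measure ℝ) : Set ℝ := momentDom μ (llr μ ν)

/-- The rate function of the log-likelihood ratio under `ν`. -/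
def I₀ (ν μ : Measure ℝ) : ℝ → EReal := rateFn ν (llr μ ν)

/-- The rate function of the log-likelihood ratio under `μ`. -/
def I₁ (ν μ : Measure ℝ) : ℝ → EReal := rateFn μ (llr μ ν)

/-- The divergence `D(1‖0)`. A Bochner integral is `0` when its integrand is not integrable, so
`0 < D₁₀ ν μ` says that the divergence is finite and positive. -/
def D₁₀ (ν μ : Measure ℝ) : ℝ := ∫ y, llr μ ν y ∂μ

/-- The divergence `D(0‖1)`; `0 < D₀₁ ν μ` says that it is finite and positive. -/
def D₀₁ (ν μ : Measure ℝ) : ℝ := -∫ y, llr μ ν y ∂ν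

/-- The smaller of the two divergences. -/
def Dmin (ν μ : Measure ℝ) : ℝ := min (D₀₁ ν μ) (D₁₀ ν μ)

/-- The Chernoff information `C = I₀(0)`. -/
def chernoff (ν μ : Measure ℝ) : EReal := I₀ ν μ 0

/-- `I₀⁻¹(z) = max {x | I₀(x) = z}` (whenever the maximum exists). -/
def I₀inv (ν μ : Measure ℝ) (z : ℝ) : ℝ := sSup {x : ℝ | I₀ ν μ x = (z : EReal)}

/-- `I₁⁻¹(z) = min {x | I₁(x) = z}` (whenever the minimum exists). -/
def I₁inv (ν μ : Measure ℝ) (z : ℝ) : ℝ := sInf {x : ℝ | I₁ ν μ x = (z : EReal)}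

/-- The trade-off function
`h(z) = (m - n) min {I₀(I₁⁻¹(z / (m - n))), I₁(I₀⁻¹(z / (m - n)))}`. -/
def tradeoff (ν μ : Measure ℝ) (m n : ℕ) (z : ℝ) : EReal :=
  (((m : ℝ) - (n : ℝ) : ℝ) : EReal) *
    min (I₀ ν μ (I₁inv ν μ (z / ((m : ℝ) - (n : ℝ)))))
      (I₁ ν μ (I₀inv ν μ (z / ((m : ℝ) - (n : ℝ)))))

/-! ### Measurements -/

/-- Law of one benign scalar measurement: `ν` under `θ = 0` and `μ` under `θ = 1`. -/
def law (ν μ : Measure ℝ) (θ : Fin 2) : Measure ℝ := if θ = 0 then ν else μ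

instance (ν μ : Measure ℝ) [IsProbabilityMeasure ν] [IsProbabilityMeasure μ] (θ : Fin 2) :
    IsProbabilityMeasure (law ν μ θ) := by
  unfold law; split_ifs <;> infer_instance

/-- Joint law of all true measurements: `y t i` is the measurement of sensor `i` at the
`(t + 1)`-st time step, and all of them are i.i.d. given `θ`. -/
def trueLaw (ν μ : Measure ℝ) [IsProbabilityMeasure ν] [IsProbabilityMeasure μ] (m : ℕ)
    (θ : Fin 2) : Measure (ℕ → Fin m → ℝ) :=
  Measure.infinitePi (fun _ : ℕ => Measure.pi (fun _ : Fin m => law ν μ θ))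

/-! ### Detection rules and attacks -/

/-- A detection rule: at time `k` it maps the measurements received at the first `k` time steps to
the probability of deciding `1`. (The value at `k = 0` never matters.) -/
structure DetectionRule (m : ℕ) where
  toFun : (k : ℕ) → (Fin k → Fin m → ℝ) → ℝ
  measurable_toFun : ∀ k, Measurable (toFun k)
  mem_Icc : ∀ k Y, toFun k Y ∈ Set.Icc (0 : ℝ) 1

/-- A causal, possibly randomized strategy of an attacker. `bias I θ t` computes the bias vector
injected at the `(t + 1)`-st time step, when `I` is the set of compromised sensors and `θ` the true
state, from the true measurements of the sensors in `I` up to and including this step, from the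
bias vectors of the earlier steps, and from a private random seed that is independent of the true
measurements. -/
structure AttackStrategy (m : ℕ) where
  Seed : Type
  [measurableSpaceSeed : MeasurableSpace Seed]
  seedLaw : Measure Seed
  [isProbabilityMeasure_seedLaw : IsProbabilityMeasure seedLaw]
  bias : (I : Finset (Fin m)) → (θ : Fin 2) → (t : ℕ) →
    (Fin (t + 1) → I → ℝ) → (Fin t → Fin m → ℝ) → Seed → Fin m → ℝ
  measurable_bias : ∀ (I : Finset (Fin m)) (θ : Fin 2) (t : ℕ), Measurable
    (fun p : (Fin (t + 1) → I → ℝ) × (Fin t → Fin m → ℝ) × Seed =>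
      bias I θ t p.1 p.2.1 p.2.2)

attribute [instance] AttackStrategy.measurableSpaceSeed
  AttackStrategy.isProbabilityMeasure_seedLaw

/-- The strategy that never changes a measurement. -/
def zeroAttack (m : ℕ) : AttackStrategy m where
  Seed := Unit
  seedLaw := Measure.dirac ()
  bias := fun _ _ _ _ _ _ => 0
  measurable_bias := fun _ _ _ => measurable_const

variable {m : ℕ}

/-- The sequence of injected bias vectors. -/
def AttackStrategy.biasSeq (g : AttackStrategy m) (I : Finset (Fin m)) (θ : Fin 2)
    (y : ℕ → Fin m → ℝ) (ξ : g.Seed) (t : ℕ) : Fin m → ℝ :=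
  g.bias I θ t (fun s i => y s i) (fun s => g.biasSeq I θ y ξ s) ξ
termination_by t
decreasing_by exact s.isLt

/-- The manipulated measurements received at the first `k` time steps. -/
def AttackStrategy.received (g : AttackStrategy m) (I : Finset (Fin m)) (θ : Fin 2) (k : ℕ)
    (y : ℕ → Fin m → ℝ) (ξ : g.Seed) : Fin k → Fin m → ℝ :=
  fun t i => y t i + g.biasSeq I θ y ξ t i

/-- Joint law of the true measurements and the seed of the attacker. -/
def AttackStrategy.jointLaw (g : AttackStrategy m) (ν μ : Measure ℝ) [IsProbabilityMeasure ν]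
    [IsProbabilityMeasure μ] (θ : Fin 2) : Measure ((ℕ → Fin m → ℝ) × g.Seed) :=
  (trueLaw ν μ m θ).prod g.seedLaw

/-- A strategy is admissible if, for each set `I` of `n` compromised sensors and either state, the
set of sensors that are ever biased is (almost surely) equal to `I`. -/
def AttackStrategy.Admissible (g : AttackStrategy m) (ν μ : Measure ℝ) [IsProbabilityMeasure ν]
    [IsProbabilityMeasure μ] (n : ℕ) : Prop :=
  ∀ (I : Finset (Fin m)) (θ : Fin 2), I.card = n →
    ∀ᵐ p ∂(g.jointLaw ν μ θ),
      (⋃ t : ℕ, Function.support (g.biasSeq I θ p.1 p.2 t)) = (I : Set (Fin m))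

/-! ### Performance -/

section Performance

variable (ν μ : Measure ℝ) [IsProbabilityMeasure ν] [IsProbabilityMeasure μ]

/-- Probability of error `e(θ, I, k)` at time `k`. -/
def errorProb (f : DetectionRule m) (g : AttackStrategy m) (θ : Fin 2) (I : Finset (Fin m))
    (k : ℕ) : ℝ :=
  if θ = 0 then ∫ p, f.toFun k (g.received I θ k p.1 p.2) ∂(g.jointLaw ν μ θ)
  else 1 - ∫ p, f.toFun k (g.received I θ k p.1 p.2) ∂(g.jointLaw ν μ θ)

/-- Worst-case probability of error `ε(k)`: the maximum of `e(θ, I, k)` over both states and all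
sets `I` of `n` sensors. -/
def worstError (n : ℕ) (f : DetectionRule m) (g : AttackStrategy m) (k : ℕ) : ENNReal :=
  ⨆ (θ : Fin 2) (I : {I : Finset (Fin m) // I.card = n}),
    ENNReal.ofReal (errorProb ν μ f g θ I k)

/-- The rate `ρ(f, g) = liminf (- log ε(k) / k)`, where `log 0 = -∞`. -/
def rate (n : ℕ) (f : DetectionRule m) (g : AttackStrategy m) : EReal :=
  liminf (fun k : ℕ => -ENNReal.log (worstError ν μ n f g k) / (k : EReal)) atTop

/-- Efficiency: the rate in the absence of an attack. -/
def efficiency (n : ℕ) (f : DetectionRule m) : EReal :=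
  rate ν μ n f (zeroAttack m)

/-- Security: the infimum of the rate over the admissible attacks. -/
def security (n : ℕ) (f : DetectionRule m) : EReal :=
  ⨅ (g : AttackStrategy m) (_ : g.Admissible ν μ n), rate ν μ n f g

end Performance

end ByzantineDetection

end

open ByzantineDetection

/-!
Apart from the comparison of security with efficiency, all bounds come from one converse
inequality. Write `λ` for the log-likelihood ratio and `Λ` for its cumulant generating function
under `ν`; since `dμ = exp λ dν`, the one under `μ` is
`Λ (· + 1)`, and `I₁ x = I₀ x - x`. For a tilt `w ∈ [0, 1]` let `x = Λ' w`. The law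
`dν_w = exp (w λ - Λ w) dν` has mean `x` for `λ`, and its log-densities over `ν` and `μ`,
`w λ - Λ w` and `(w - 1) λ - Λ w`, take at `λ = x` the values `I₀ x` and `I₁ x`
(`I₀_deriv`, `I₁_deriv`; these are `rate₀ w` and `rate₁ w`). If the law of the received data in
state `0` and the one in state `1` differ in `N` sensors only, tilt these `N` sensors. By the weak
law of large numbers the log-densities are about `k N I₀ x` and `k N I₁ x` on an event of
probability at least `1 / 2` under the tilted law, and integrating `f + (1 - f) = 1` over it gives
`exp (k (N I₀ x + δ)) e₀ + exp (k (N I₁ x + δ)) e₁ ≥ 1 / 2` eventually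
(`eventually_half_le_exp_mul_errors`). Hence an exponent of `e₁` above `N I₁ x` caps the exponent of
`e₀` by `N I₀ x`, and conversely (`rate_le_rate₀_of_lt_rate`, `rate_le_rate₁_of_lt_rate`).

The attacks needed all replace the measurements of a compromised sensor by fresh samples of `ν` or
of `μ` (`substitutionAttack`). They are admissible because `ν` and `μ` are not point masses, so a fresh
sample eventually differs from the true one.
* With no attack, `N = m`; at the tilt with `Λ' w = 0` both exponents are the Chernoff information.
* Two sets of `n` sensors, one compromised in each state, can be made to report the same law in both
  states, which leaves `N = (m - 2n)⁺` informative sensors.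
* Samples of the correct law change nothing, so security is at most efficiency.
* Samples of `μ` in both states make state `1` look unattacked, and leave `N = m - n` sensors in
  which state `0` differs from it. The efficiency bounds `e₁`, so any tilt with
  `(m - n) rate₁ w < z` gives security at most `(m - n) rate₀ w`; samples of `ν` give the
  symmetric bound. Letting `w` tend to the extremal tilt with `(m - n) rate₁ w = z` gives the
  trade-off function, as `Λ' w` is then the required minimum `I₁⁻¹ (z / (m - n))`. At
  `z ≥ (m - n) Dmin` the limiting bound is `0`.
-/

open ByzantineDetection

namespace ByzantineDetection

open scoped Topology ENNReal

/-! ### The log-likelihood ratio: cumulant generating function and rate functions -/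

section LogMgf

variable (ν μ : Measure ℝ)

/-- The cumulant generating function `Λ` of the log-likelihood ratio `λ` under `ν`. Since
`dμ = exp λ dν`, the one under `μ` is `w ↦ Λ (w + 1)`, so `Λ` serves both states. -/
noncomputable def logMgf : ℝ → ℝ := cgf (llr μ ν) ν

/-- The value of `I₀` at the point `Λ' w`, as a function of the tilt `w`; see `I₀_deriv`. -/
noncomputable def rate₀ (w : ℝ) : ℝ := w * deriv (logMgf ν μ) w - logMgf ν μ w

/-- The value of `I₁` at the point `Λ' w`, as a function of the tilt `w`; see `I₁_deriv`. -/
noncomputable def rate₁ (w : ℝ) : ℝ := (w - 1) * deriv (logMgf ν μ) w - logMgf ν μ w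

lemma momentDom_eq_integrableExpSet {ω : Measure ℝ} {X : ℝ → ℝ} (hX : Measurable X) :
    momentDom ω X = integrableExpSet X ω := by
  ext w
  simp only [momentDom, momentGen, integrableExpSet, Set.mem_ofPred_eq]
  rw [← hasFiniteIntegral_iff_ofReal (ae_of_all _ fun _ => (Real.exp_pos _).le)]
  exact ⟨fun h => ⟨by fun_prop, h⟩, fun h => h.2⟩

variable {ν μ}

lemma withDensity_exp_llr [IsProbabilityMeasure ν] [IsProbabilityMeasure μ]
    (hνμ : ν ≪ μ) (hμν : μ ≪ ν) :
    ν.withDensity (fun y => ENNReal.ofReal (Real.exp (llr μ ν y))) = μ := by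
  rw [← Measure.withDensity_rnDeriv_eq μ ν hμν]
  refine withDensity_congr_ae ?_
  rw [Measure.withDensity_rnDeriv_eq μ ν hμν]
  filter_upwards [exp_llr_of_ac' μ ν hνμ, Measure.rnDeriv_lt_top μ ν] with y hy hy'
  rw [hy, ENNReal.ofReal_toReal hy'.ne]

/-- `M₁ w = M₀ (w + 1)`. -/
lemma momentGen_llr_right [IsProbabilityMeasure ν] [IsProbabilityMeasure μ]
    (hνμ : ν ≪ μ) (hμν : μ ≪ ν) (w : ℝ) :
    momentGen μ (llr μ ν) w = momentGen ν (llr μ ν) (w + 1) := by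
  unfold momentGen
  have h : ∀ g : ℝ → ENNReal, Measurable g →
      ∫⁻ y, g y ∂μ = ∫⁻ y, ENNReal.ofReal (Real.exp (llr μ ν y)) * g y ∂ν := fun g hg => by
    conv_lhs => rw [← withDensity_exp_llr hνμ hμν]
    exact lintegral_withDensity_eq_lintegral_mul _ (by fun_prop) hg
  rw [h _ (by fun_prop)]
  refine lintegral_congr fun y => ?_
  rw [← ENNReal.ofReal_mul (Real.exp_pos _).le, ← Real.exp_add]
  congr 2
  ring

lemma Icc_subset_interior_integrableExpSet [IsProbabilityMeasure ν] [IsProbabilityMeasure μ]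
    (hνμ : ν ≪ μ) (hμν : μ ≪ ν)
    (hdom₀ : (0 : ℝ) ∈ interior (dom₀ ν μ)) (hdom₁ : (0 : ℝ) ∈ interior (dom₁ ν μ)) :
    Set.Icc (0 : ℝ) 1 ⊆ interior (integrableExpSet (llr μ ν) ν) := by
  have h0 : dom₀ ν μ = integrableExpSet (llr μ ν) ν :=
    momentDom_eq_integrableExpSet (measurable_llr _ _)
  have h1 : dom₁ ν μ = (Homeomorph.addRight (1 : ℝ)) ⁻¹' dom₀ ν μ := by
    ext w
    simp [dom₀, dom₁, momentDom, momentGen_llr_right hνμ hμν]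
  rw [h1, ← Homeomorph.preimage_interior] at hdom₁
  rw [← h0]
  have hc : Convex ℝ (interior (dom₀ ν μ)) := by
    rw [h0]; exact Convex.interior (convex_integrableExpSet (X := llr μ ν) (μ := ν))
  have := hc.segment_subset hdom₀ (y := 1) (by simpa using hdom₁)
  rwa [segment_eq_Icc zero_le_one] at this

lemma momentGen_eq_exp_logMgf [IsProbabilityMeasure ν]
    {w : ℝ} (hw : w ∈ integrableExpSet (llr μ ν) ν) :
    momentGen ν (llr μ ν) w = ENNReal.ofReal (Real.exp (logMgf ν μ w)) := by
  have hw' : Integrable (fun y => Real.exp (w * llr μ ν y)) ν := hw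
  rw [logMgf, exp_cgf hw', mgf, momentGen,
    ofReal_integral_eq_lintegral_ofReal hw' (ae_of_all _ fun _ => (Real.exp_pos _).le)]

lemma logMgf_zero [IsProbabilityMeasure ν] : logMgf ν μ 0 = 0 := cgf_zero

lemma logMgf_one [IsProbabilityMeasure ν] [IsProbabilityMeasure μ]
    (hνμ : ν ≪ μ) (hμν : μ ≪ ν) : logMgf ν μ 1 = 0 := by
  have : mgf (llr μ ν) ν 1 = 1 := by
    have h := congrArg (fun ρ => ρ Set.univ) (withDensity_exp_llr hνμ hμν)
    simp only [measure_univ, withDensity_apply _ MeasurableSet.univ, Measure.restrict_univ] at h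
    rw [mgf, integral_eq_lintegral_of_nonneg_ae (ae_of_all _ fun _ => (Real.exp_pos _).le)
      (by fun_prop)]
    simp [h]
  rw [logMgf, cgf, this, Real.log_one]

lemma deriv_logMgf_zero [IsProbabilityMeasure ν]
    (h : (0 : ℝ) ∈ interior (integrableExpSet (llr μ ν) ν)) :
    deriv (logMgf ν μ) 0 = -D₀₁ ν μ := by
  simp [logMgf, deriv_cgf_zero h, D₀₁]

lemma deriv_logMgf_one [IsProbabilityMeasure ν] [IsProbabilityMeasure μ] (hνμ : ν ≪ μ) (hμν : μ ≪ ν)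
    (h : (1 : ℝ) ∈ interior (integrableExpSet (llr μ ν) ν)) :
    deriv (logMgf ν μ) 1 = D₁₀ ν μ := by
  have h1 : Real.exp (cgf (llr μ ν) ν 1) = 1 := by
    rw [Real.exp_eq_one_iff]; exact logMgf_one hνμ hμν
  rw [exp_cgf (interior_subset (s := integrableExpSet _ _) h)] at h1
  rw [logMgf, deriv_cgf h, h1, div_one, D₁₀]
  have h : ∀ g : ℝ → ℝ, ∫ y, g y ∂μ = ∫ y, Real.exp (llr μ ν y) * g y ∂ν := fun g => by
    conv_lhs => rw [← withDensity_exp_llr hνμ hμν]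
    rw [integral_withDensity_eq_integral_toReal_smul (by fun_prop) (by simp)]
    simp [Real.exp_nonneg]
  rw [h]
  simp [mul_comm]

/-- The graph of `Λ` lies above its tangent at `w`. Stated for `momentGen`, so that `v` may lie
outside the domain; the reason is `exp u ≥ 1 + u` with `u = (v - w) (λ - Λ' w)`, integrated against
the tilted measure, under which `u` has mean `0`. -/
lemma logMgf_tangent [IsProbabilityMeasure ν]
    {w : ℝ} (hw : w ∈ interior (integrableExpSet (llr μ ν) ν)) (v : ℝ) :
    ENNReal.ofReal (Real.exp (logMgf ν μ w + (v - w) * deriv (logMgf ν μ) w)) ≤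
      momentGen ν (llr μ ν) v := by
  by_cases hv : v ∈ integrableExpSet (llr μ ν) ν
  swap
  · rw [← momentDom_eq_integrableExpSet (measurable_llr _ _), momentDom, Set.mem_ofPred_eq,
      not_lt, top_le_iff] at hv
    simp [hv]
  have hw' : Integrable (fun y => Real.exp (w * llr μ ν y)) ν :=
    interior_subset (s := integrableExpSet _ _) hw
  have hv' : Integrable (fun y => Real.exp (v * llr μ ν y)) ν := hv
  rw [momentGen_eq_exp_logMgf hv]
  refine ENNReal.ofReal_le_ofReal ?_
  rw [Real.exp_add, logMgf, exp_cgf hw', exp_cgf hv']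
  set x := deriv (cgf (llr μ ν) ν) w with hx
  have hM : 0 < mgf (llr μ ν) ν w := mgf_pos hw'
  have hxm : ∫ y, llr μ ν y * Real.exp (w * llr μ ν y) ∂ν = x * mgf (llr μ ν) ν w := by
    rw [hx, deriv_cgf hw, div_mul_cancel₀ _ hM.ne']
  have hi : Integrable (fun y => llr μ ν y * Real.exp (w * llr μ ν y)) ν := by
    simpa using integrable_pow_mul_exp_of_mem_interior_integrableExpSet hw 1
  have key : ∫ y, (Real.exp ((v - w) * x) * ((1 - (v - w) * x) * Real.exp (w * llr μ ν y) +
      (v - w) * (llr μ ν y * Real.exp (w * llr μ ν y)))) ∂ν ≤ mgf (llr μ ν) ν v := by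
    refine integral_mono (((hw'.const_mul _).add (hi.const_mul _)).const_mul _) hv' fun y => ?_
    have h1 := Real.add_one_le_exp ((v - w) * (llr μ ν y - x))
    have h2 : Real.exp (v * llr μ ν y) = Real.exp ((v - w) * x) * Real.exp (w * llr μ ν y) *
        Real.exp ((v - w) * (llr μ ν y - x)) := by
      rw [← Real.exp_add, ← Real.exp_add]; congr 1; ring
    simp only
    rw [h2]
    have h3 : 0 ≤ Real.exp ((v - w) * x) * Real.exp (w * llr μ ν y) := by positivity
    nlinarith [mul_le_mul_of_nonneg_left h1 h3]
  rw [integral_const_mul, integral_add (hw'.const_mul _) (hi.const_mul _), integral_const_mul,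
    integral_const_mul, hxm] at key
  have : ∫ y, Real.exp (w * llr μ ν y) ∂ν = mgf (llr μ ν) ν w := rfl
  rw [this] at key
  linarith

lemma le_I₀ [IsProbabilityMeasure ν] {w : ℝ} (hw : w ∈ integrableExpSet (llr μ ν) ν) (x : ℝ) :
    ((x * w - logMgf ν μ w : ℝ) : EReal) ≤ I₀ ν μ x := by
  refine le_trans ?_ (le_iSup _ w)
  rw [momentGen_eq_exp_logMgf hw, ENNReal.log_ofReal_of_pos (Real.exp_pos _), Real.log_exp]
  norm_cast

lemma le_I₁ [IsProbabilityMeasure ν] [IsProbabilityMeasure μ]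
    (hνμ : ν ≪ μ) (hμν : μ ≪ ν) {w : ℝ} (hw : w ∈ integrableExpSet (llr μ ν) ν) (x : ℝ) :
    ((x * (w - 1) - logMgf ν μ w : ℝ) : EReal) ≤ I₁ ν μ x := by
  refine le_trans ?_ (le_iSup _ (w - 1))
  rw [momentGen_llr_right hνμ hμν, sub_add_cancel,
    momentGen_eq_exp_logMgf hw, ENNReal.log_ofReal_of_pos (Real.exp_pos _), Real.log_exp]
  norm_cast

lemma log_momentGen_ge [IsProbabilityMeasure ν]
    {w : ℝ} (hw : w ∈ interior (integrableExpSet (llr μ ν) ν)) (v : ℝ) :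
    ((logMgf ν μ w + (v - w) * deriv (logMgf ν μ) w : ℝ) : EReal) ≤
      ENNReal.log (momentGen ν (llr μ ν) v) := by
  have := ENNReal.log_monotone (logMgf_tangent hw v)
  rwa [ENNReal.log_ofReal_of_pos (Real.exp_pos _), Real.log_exp] at this

lemma I₀_deriv [IsProbabilityMeasure ν] {w : ℝ} (hw : w ∈ interior (integrableExpSet (llr μ ν) ν)) :
    I₀ ν μ (deriv (logMgf ν μ) w) = (rate₀ ν μ w : EReal) := by
  refine le_antisymm (iSup_le fun v => ?_) ?_
  · refine (EReal.sub_le_sub le_rfl (log_momentGen_ge hw v)).trans ?_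
    rw [← EReal.coe_sub, EReal.coe_le_coe_iff, rate₀]
    linarith
  · rw [rate₀, mul_comm]
    exact le_I₀ (interior_subset hw) _

lemma I₁_deriv [IsProbabilityMeasure ν] [IsProbabilityMeasure μ] (hνμ : ν ≪ μ) (hμν : μ ≪ ν) {w : ℝ}
    (hw : w ∈ interior (integrableExpSet (llr μ ν) ν)) :
    I₁ ν μ (deriv (logMgf ν μ) w) = (rate₁ ν μ w : EReal) := by
  refine le_antisymm (iSup_le fun v => ?_) ?_
  · rw [momentGen_llr_right hνμ hμν]
    refine (EReal.sub_le_sub le_rfl (log_momentGen_ge hw (v + 1))).trans ?_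
    rw [← EReal.coe_sub, EReal.coe_le_coe_iff, rate₁]
    linarith
  · rw [rate₁, mul_comm]
    exact le_I₁ hνμ hμν (interior_subset hw) _

lemma logMgf_tangent_real [IsProbabilityMeasure ν]
    {w v : ℝ} (hw : w ∈ interior (integrableExpSet (llr μ ν) ν))
    (hv : v ∈ integrableExpSet (llr μ ν) ν) :
    logMgf ν μ w + (v - w) * deriv (logMgf ν μ) w ≤ logMgf ν μ v := by
  have h := logMgf_tangent hw v
  rw [momentGen_eq_exp_logMgf hv, ENNReal.ofReal_le_ofReal_iff (Real.exp_pos _).le] at h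
  exact Real.exp_le_exp.1 h

lemma continuousOn_logMgf :
    ContinuousOn (logMgf ν μ) (interior (integrableExpSet (llr μ ν) ν)) :=
  analyticOnNhd_cgf.continuousOn

lemma continuousOn_deriv_logMgf :
    ContinuousOn (deriv (logMgf ν μ)) (interior (integrableExpSet (llr μ ν) ν)) :=
  analyticOnNhd_cgf.deriv.continuousOn

lemma continuousOn_rate₀ :
    ContinuousOn (rate₀ ν μ) (interior (integrableExpSet (llr μ ν) ν)) :=
  (continuousOn_id.mul continuousOn_deriv_logMgf).sub continuousOn_logMgf

lemma continuousOn_rate₁ :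
    ContinuousOn (rate₁ ν μ) (interior (integrableExpSet (llr μ ν) ν)) :=
  ((continuousOn_id.sub continuousOn_const).mul continuousOn_deriv_logMgf).sub continuousOn_logMgf

end LogMgf

/-! ### Change of measure and the law of large numbers on product spaces -/

section ChangeOfMeasure

/-- Densities multiply over independent coordinates, so log-densities add. -/
lemma pi_withDensity_exp {ι : Type*} [Fintype ι] {Ω : ι → Type*} [∀ i, MeasurableSpace (Ω i)]
    (P Q : ∀ i, Measure (Ω i)) [∀ i, IsProbabilityMeasure (P i)] [∀ i, IsProbabilityMeasure (Q i)]
    {a : ∀ i, Ω i → ℝ} (ha : ∀ i, Measurable (a i))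
    (hQ : ∀ i, Q i = (P i).withDensity fun y => ENNReal.ofReal (Real.exp (a i y))) :
    Measure.pi Q = (Measure.pi P).withDensity
      fun y => ENNReal.ofReal (Real.exp (∑ i, a i (y i))) := by
  refine Measure.pi_eq fun s hs => ?_
  have hind : iIndepFun (fun i (y : ∀ i, Ω i) =>
      (s i).indicator (fun z => ENNReal.ofReal (Real.exp (a i z))) (y i)) (Measure.pi P) :=
    iIndepFun_pi (X := fun i => (s i).indicator (fun z => ENNReal.ofReal (Real.exp (a i z))))
      fun i => (Measurable.indicator (by fun_prop) (hs i)).aemeasurable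
  have hm : ∀ i, Measurable ((s i).indicator (fun z => ENNReal.ofReal (Real.exp (a i z)))) :=
    fun i => Measurable.indicator (by fun_prop) (hs i)
  rw [withDensity_apply _ (.univ_pi hs), ← lintegral_indicator (.univ_pi hs)]
  have h1 : (Set.univ.pi s).indicator (fun y => ENNReal.ofReal (Real.exp (∑ i, a i (y i)))) =
      fun y => ∏ i, (s i).indicator (fun z => ENNReal.ofReal (Real.exp (a i z))) (y i) := by
    ext y
    by_cases hy : y ∈ Set.univ.pi s
    · rw [Set.indicator_of_mem hy, Real.exp_sum,
        ENNReal.ofReal_prod_of_nonneg fun _ _ => (Real.exp_pos _).le]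
      exact Finset.prod_congr rfl fun i _ => (Set.indicator_of_mem (hy i (Set.mem_univ i))
          fun z => ENNReal.ofReal (Real.exp (a i z))).symm
    · rw [Set.indicator_of_notMem hy]
      simp only [Set.mem_univ_pi, not_forall] at hy
      obtain ⟨i, hi⟩ := hy
      exact (Finset.prod_eq_zero (Finset.mem_univ i) (Set.indicator_of_notMem hi _)).symm
  rw [h1, lintegral_prod_eq_prod_lintegral_of_indepFun _ _ hind
    fun i => (hm i).comp (measurable_pi_apply i)]
  refine Finset.prod_congr rfl fun i _ => ?_
  rw [(measurePreserving_eval P i).lintegral_comp (hm i), lintegral_indicator (hs i), hQ i,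
    withDensity_apply _ (hs i)]

lemma setLIntegral_withDensity_exp_le {Ω : Type*} [MeasurableSpace Ω] {A : Measure Ω}
    {d : Ω → ℝ} (hd : Measurable d) {G : Set Ω} (hG : MeasurableSet G) {c : ℝ}
    (hc : ∀ z ∈ G, d z ≤ c) {g : Ω → ℝ≥0∞} (hg : Measurable g) :
    ∫⁻ z in G, g z ∂(A.withDensity fun z => ENNReal.ofReal (Real.exp (d z))) ≤
      ENNReal.ofReal (Real.exp c) * ∫⁻ z, g z ∂A := by
  rw [setLIntegral_withDensity_eq_setLIntegral_mul _ (by fun_prop) hg hG]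
  calc ∫⁻ z in G, _ * g z ∂A ≤ ∫⁻ z in G, ENNReal.ofReal (Real.exp c) * g z ∂A := by
        refine setLIntegral_mono (by fun_prop) fun z hz => ?_
        gcongr
        exact hc z hz
    _ ≤ ∫⁻ z, ENNReal.ofReal (Real.exp c) * g z ∂A := setLIntegral_le_lintegral _ _
    _ = _ := lintegral_const_mul _ hg

/-- If `Q` has log-density at most `c` over `A` and at most `d` over `B` on the event `G`, then a
test `f` cannot have small errors under both `A` and `B`: on `G`, split `1 = f + (1 - f)`. -/
lemma measureReal_le_exp_mul_add_exp_mul {Ω : Type*} [MeasurableSpace Ω] {A B Q : Measure Ω}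
    [IsProbabilityMeasure A] [IsProbabilityMeasure B] [IsProbabilityMeasure Q]
    {a b : Ω → ℝ} (ha : Measurable a) (hb : Measurable b)
    (hA : Q = A.withDensity fun z => ENNReal.ofReal (Real.exp (a z)))
    (hB : Q = B.withDensity fun z => ENNReal.ofReal (Real.exp (b z)))
    {G : Set Ω} (hG : MeasurableSet G) {c d : ℝ} (hc : ∀ z ∈ G, a z ≤ c) (hd : ∀ z ∈ G, b z ≤ d)
    {f : Ω → ℝ} (hf : Measurable f) (hf01 : ∀ z, f z ∈ Set.Icc (0 : ℝ) 1) :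
    Q.real G ≤ Real.exp c * ∫ z, f z ∂A + Real.exp d * (1 - ∫ z, f z ∂B) := by
  have hint : ∀ P : Measure Ω, IsProbabilityMeasure P → Integrable f P := fun P _ =>
    Integrable.of_mem_Icc 0 1 hf.aemeasurable (ae_of_all _ hf01)
  have h0 : 0 ≤ ∫ z, f z ∂A := integral_nonneg fun z => (hf01 z).1
  have h1 : 1 - ∫ z, f z ∂B = ∫ z, (1 - f z) ∂B := by
    rw [integral_sub (integrable_const _) (hint B ‹_›)]; simp
  have h2 : 0 ≤ ∫ z, (1 - f z) ∂B := integral_nonneg fun z => sub_nonneg.2 (hf01 z).2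
  rw [h1, measureReal_def]
  refine ENNReal.toReal_le_of_le_ofReal (by positivity) ?_
  rw [ENNReal.ofReal_add (by positivity) (by positivity), ENNReal.ofReal_mul (Real.exp_pos _).le,
    ENNReal.ofReal_mul (Real.exp_pos _).le,
    ofReal_integral_eq_lintegral_ofReal (hint A ‹_›) (ae_of_all _ fun z => (hf01 z).1),
    ofReal_integral_eq_lintegral_ofReal (f := fun z => 1 - f z)
      ((integrable_const _).sub (hint B ‹_›))
      (ae_of_all _ fun z => sub_nonneg.2 (hf01 z).2)]
  calc Q G = ∫⁻ z in G, (ENNReal.ofReal (f z) + ENNReal.ofReal (1 - f z)) ∂Q := by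
        simp_rw [← ENNReal.ofReal_add (hf01 _).1 (sub_nonneg.2 (hf01 _).2)]
        simp
    _ = ∫⁻ z in G, ENNReal.ofReal (f z) ∂Q + ∫⁻ z in G, ENNReal.ofReal (1 - f z) ∂Q :=
        lintegral_add_left (by fun_prop) _
    _ ≤ _ := by
        refine add_le_add ?_ ?_
        · conv_lhs => rw [hA]
          exact setLIntegral_withDensity_exp_le ha hG hc (by fun_prop)
        · conv_lhs => rw [hB]
          exact setLIntegral_withDensity_exp_le hb hG hd (by fun_prop)

/-- The weak law of large numbers for i.i.d. samples, by Chebyshev's inequality. -/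
lemma eventually_half_le_measureReal_pi {Ω : Type*} [MeasurableSpace Ω] (Q : Measure Ω)
    [IsProbabilityMeasure Q] {T : Ω → ℝ} (hT : MemLp T 2 Q) (hTm : Measurable T)
    {δ : ℝ} (hδ : 0 < δ) :
    ∀ᶠ k : ℕ in atTop, 1 / 2 ≤ (Measure.pi fun _ : Fin k => Q).real
      {z | |∑ t, T (z t) - k * ∫ y, T y ∂Q| < k * δ} := by
  have hlim : Tendsto (fun k : ℕ => (Var[T; Q] / δ ^ 2) / (k : ℝ)) atTop (𝓝 0) :=
    tendsto_const_div_atTop_nhds_zero_nat _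
  filter_upwards [hlim.eventually_lt_const (show (0 : ℝ) < 1 / 2 by norm_num),
    eventually_gt_atTop 0] with k hk hk0
  have hk0' : (0 : ℝ) < k := by exact_mod_cast hk0
  have hmem : ∀ t : Fin k, MemLp (fun z : Fin k → Ω => T (z t)) 2 (Measure.pi fun _ => Q) :=
    fun t => hT.comp_measurePreserving (measurePreserving_eval _ t)
  have hsum : MemLp (fun z : Fin k → Ω => ∑ t, T (z t)) 2 (Measure.pi fun _ => Q) :=
    memLp_finsetSum _ fun t _ => hmem t
  have hmean : ∫ z : Fin k → Ω, ∑ t, T (z t) ∂(Measure.pi fun _ => Q) = k * ∫ y, T y ∂Q := by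
    rw [integral_finsetSum _ fun t _ => (hmem t).integrable one_le_two]
    have : ∀ t : Fin k, ∫ z : Fin k → Ω, T (z t) ∂(Measure.pi fun _ => Q) = ∫ y, T y ∂Q :=
      fun t => integral_comp_eval (μ := fun _ : Fin k => Q) hTm.aestronglyMeasurable
    simp [this]
  have hvar : Var[fun z : Fin k → Ω => ∑ t, T (z t); Measure.pi fun _ => Q] = k * Var[T; Q] := by
    have := variance_sum_pi (μ := fun _ : Fin k => Q) (X := fun _ => T) fun _ => hT
    simp only [Finset.sum_const, Finset.card_univ, Fintype.card_fin, nsmul_eq_mul] at this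
    rw [← this]
    congr 1
    ext z
    simp
  have hcheb := meas_ge_le_variance_div_sq hsum (mul_pos hk0' hδ)
  rw [hmean, hvar] at hcheb
  have hle : k * Var[T; Q] / (k * δ) ^ 2 ≤ 1 / 2 := by
    refine le_trans (le_of_eq ?_) hk.le
    field_simp
  have hG : MeasurableSet {z : Fin k → Ω | |∑ t, T (z t) - k * ∫ y, T y ∂Q| < k * δ} :=
    measurableSet_lt (by fun_prop) (by fun_prop)
  have hc : {z : Fin k → Ω | |∑ t, T (z t) - k * ∫ y, T y ∂Q| < k * δ}ᶜ =
      {z | k * δ ≤ |∑ t, T (z t) - k * ∫ y, T y ∂Q|} := by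
    ext z; simp
  have hcomp := probReal_add_probReal_compl hG (μ := Measure.pi fun _ : Fin k => Q)
  rw [hc] at hcomp
  have : (Measure.pi fun _ : Fin k => Q).real {z | k * δ ≤ |∑ t, T (z t) - k * ∫ y, T y ∂Q|}
      ≤ 1 / 2 :=
    ENNReal.toReal_le_of_le_ofReal (by norm_num) (hcheb.trans (ENNReal.ofReal_le_ofReal hle))
  linarith

/-- The two errors of any sequence of tests between `A` and `B` from `k` i.i.d. samples satisfy a
linear constraint for each law `Q` whose log-densities over `A` and `B` are affine in one
statistic `T`: on the event where the empirical mean of `T` is within `δ` of its `Q`-mean, these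
log-densities are controlled, and that event has `Q`-probability at least `1 / 2` eventually. -/
theorem eventually_half_le_exp_mul_integral_pi {Ω : Type*} [MeasurableSpace Ω] {A B Q : Measure Ω}
    [IsProbabilityMeasure A] [IsProbabilityMeasure B] [IsProbabilityMeasure Q]
    {T : Ω → ℝ} (hT : MemLp T 2 Q) (hTm : Measurable T) {v₀ v₁ c : ℝ}
    (hv₀ : |v₀| ≤ 1) (hv₁ : |v₁| ≤ 1)
    (hA : Q = A.withDensity fun z => ENNReal.ofReal (Real.exp (v₀ * T z - c)))
    (hB : Q = B.withDensity fun z => ENNReal.ofReal (Real.exp (v₁ * T z - c)))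
    {f : ∀ k, (Fin k → Ω) → ℝ} (hf : ∀ k, Measurable (f k))
    (hf01 : ∀ k z, f k z ∈ Set.Icc (0 : ℝ) 1) {δ : ℝ} (hδ : 0 < δ) :
    ∀ᶠ k : ℕ in atTop, 1 / 2 ≤
      Real.exp (k * (v₀ * ∫ y, T y ∂Q - c + δ)) * ∫ z, f k z ∂(Measure.pi fun _ => A) +
      Real.exp (k * (v₁ * ∫ y, T y ∂Q - c + δ)) * (1 - ∫ z, f k z ∂(Measure.pi fun _ => B)) := by
  filter_upwards [eventually_half_le_measureReal_pi Q hT hTm hδ] with k hk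
  refine hk.trans ?_
  set x := ∫ y, T y ∂Q
  have hbound : ∀ v : ℝ, |v| ≤ 1 → ∀ z ∈ {z : Fin k → Ω | |∑ t, T (z t) - k * x| < k * δ},
      ∑ t, (v * T (z t) - c) ≤ k * (v * x - c + δ) := by
    intro v hv z hz
    have hz' : |∑ t, T (z t) - k * x| < k * δ := hz
    have h1 : v * (∑ t, T (z t) - k * x) ≤ k * δ := by
      calc _ ≤ |v * (∑ t, T (z t) - k * x)| := le_abs_self _
        _ = |v| * |∑ t, T (z t) - k * x| := abs_mul _ _
        _ ≤ 1 * |∑ t, T (z t) - k * x| := by gcongr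
        _ ≤ k * δ := by linarith
    rw [Finset.sum_sub_distrib, ← Finset.mul_sum]
    simp only [Finset.sum_const, Finset.card_univ, Fintype.card_fin, nsmul_eq_mul]
    linarith
  exact measureReal_le_exp_mul_add_exp_mul (by fun_prop) (by fun_prop)
    (pi_withDensity_exp _ (fun _ => Q) (fun _ => by fun_prop) fun _ => hA)
    (pi_withDensity_exp _ (fun _ => Q) (fun _ => by fun_prop) fun _ => hB)
    (measurableSet_lt (by fun_prop) (by fun_prop))
    (hbound v₀ hv₀) (hbound v₁ hv₁) (hf k) (hf01 k)

end ChangeOfMeasure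

/-! ### The two error probabilities seen from a tilted law -/

section SampleLaw

variable (ν μ : Measure ℝ) {m : ℕ}

/-- Law of `k` independent time steps in which sensor `i` reports an independent sample of
`law ν μ (s i)`. -/
noncomputable def sampleLaw (s : Fin m → Fin 2) (k : ℕ) : Measure (Fin k → Fin m → ℝ) :=
  Measure.pi fun _ => Measure.pi fun i => law ν μ (s i)

instance [IsProbabilityMeasure ν] [IsProbabilityMeasure μ] (s : Fin m → Fin 2) (k : ℕ) :
    IsProbabilityMeasure (sampleLaw ν μ s k) := by
  unfold sampleLaw; infer_instance

variable {ν μ}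

lemma tilted_eq_withDensity_left [IsProbabilityMeasure ν] {w : ℝ}
    (hw : w ∈ integrableExpSet (llr μ ν) ν) :
    ν.tilted (fun y => w * llr μ ν y) =
      ν.withDensity fun y => ENNReal.ofReal (Real.exp (w * llr μ ν y - logMgf ν μ w)) := by
  have hw' : Integrable (fun y => Real.exp (w * llr μ ν y)) ν := hw
  rw [Measure.tilted]
  congr 1
  ext y
  rw [Real.exp_sub, logMgf, exp_cgf hw', mgf]

lemma tilted_eq_withDensity_right [IsProbabilityMeasure ν] [IsProbabilityMeasure μ]
    (hνμ : ν ≪ μ) (hμν : μ ≪ ν) {w : ℝ} (hw : w ∈ integrableExpSet (llr μ ν) ν) :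
    ν.tilted (fun y => w * llr μ ν y) =
      μ.withDensity fun y => ENNReal.ofReal (Real.exp ((w - 1) * llr μ ν y - logMgf ν μ w)) := by
  conv_rhs => lhs; rw [← withDensity_exp_llr hνμ hμν]
  rw [tilted_eq_withDensity_left hw, ← withDensity_mul _ (by fun_prop) (by fun_prop)]
  congr 1
  ext y
  rw [Pi.mul_apply, ← ENNReal.ofReal_mul (Real.exp_pos _).le, ← Real.exp_add]
  congr 2
  ring

/-- The constraint on the error pair for two configurations of sensors that differ in `N` sensors,
each of which follows `ν` in the first configuration and `μ` in the second. The intermediate law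
tilts these `N` sensors by `w` and leaves the common ones alone. -/
theorem eventually_half_le_exp_mul_errors [IsProbabilityMeasure ν] [IsProbabilityMeasure μ]
    (hνμ : ν ≪ μ) (hμν : μ ≪ ν) {w : ℝ} (hw : w ∈ interior (integrableExpSet (llr μ ν) ν))
    (hw01 : w ∈ Set.Icc (0 : ℝ) 1) {s₀ s₁ : Fin m → Fin 2} (hs : s₀ ≤ s₁) {N : ℕ}
    (hN : (Finset.univ.filter fun i => s₀ i ≠ s₁ i).card = N) (f : DetectionRule m)
    {δ : ℝ} (hδ : 0 < δ) :
    ∀ᶠ k : ℕ in atTop, 1 / 2 ≤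
      Real.exp (k * (N * rate₀ ν μ w + δ)) * ∫ Y, f.toFun k Y ∂(sampleLaw ν μ s₀ k) +
      Real.exp (k * (N * rate₁ ν μ w + δ)) * (1 - ∫ Y, f.toFun k Y ∂(sampleLaw ν μ s₁ k)) := by
  have hw' : w ∈ integrableExpSet (llr μ ν) ν := interior_subset hw
  set x := deriv (logMgf ν μ) w with hx
  set τ := ν.tilted (fun y => w * llr μ ν y) with hτ
  have : IsProbabilityMeasure τ := isProbabilityMeasure_tilted hw'
  -- `e` is the indicator of the sensors in which the two configurations differ.
  let q : Fin m → Measure ℝ := fun i => if s₀ i = s₁ i then law ν μ (s₀ i) else τ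
  have hq : ∀ i, IsProbabilityMeasure (q i) := fun i => by
    dsimp only [q]; split_ifs <;> infer_instance
  let e : Fin m → ℝ := fun i => if s₀ i = s₁ i then 0 else 1
  have he : ∑ i, e i = N := by
    rw [← hN, Finset.card_filter, Nat.cast_sum]
    exact Finset.sum_congr rfl fun i _ => by simp only [e]; split_ifs <;> simp_all
  have hvals : ∀ i, s₀ i ≠ s₁ i → s₀ i = 0 ∧ s₁ i = 1 := fun i hi =>
    (by decide : ∀ a b : Fin 2, a ≠ b → a ≤ b → a = 0 ∧ b = 1) _ _ hi (hs i)
  have hq₀ : ∀ i, q i = (law ν μ (s₀ i)).withDensity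
      fun y => ENNReal.ofReal (Real.exp (e i * (w * llr μ ν y - logMgf ν μ w))) := fun i => by
    by_cases hi : s₀ i = s₁ i
    · simp only [q, e, hi, if_true, zero_mul, Real.exp_zero, ENNReal.ofReal_one]
      exact withDensity_one.symm
    · simp only [q, e, hi, if_false, one_mul]
      rw [(hvals i hi).1]
      exact tilted_eq_withDensity_left hw'
  have hq₁ : ∀ i, q i = (law ν μ (s₁ i)).withDensity
      fun y => ENNReal.ofReal (Real.exp (e i * ((w - 1) * llr μ ν y - logMgf ν μ w))) := fun i => by
    by_cases hi : s₀ i = s₁ i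
    · simp only [q, e, hi, if_true, zero_mul, Real.exp_zero, ENNReal.ofReal_one]
      exact withDensity_one.symm
    · simp only [q, e, hi, if_false, one_mul]
      rw [(hvals i hi).2]
      exact tilted_eq_withDensity_right hνμ hμν hw'
  let T : (Fin m → ℝ) → ℝ := fun y => ∑ i, e i * llr μ ν (y i)
  have hTm : Measurable T := by fun_prop
  have hmem : ∀ i, MemLp (fun y => e i * llr μ ν y) 2 (q i) := fun i => by
    by_cases hi : s₀ i = s₁ i
    · simp [e, hi]
    · simp only [q, e, hi, if_false, one_mul]
      exact memLp_tilted_mul hw 2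
  have hmean : ∀ i, ∫ y, e i * llr μ ν y ∂(q i) = e i * x := fun i => by
    by_cases hi : s₀ i = s₁ i
    · simp [e, hi]
    · simp only [q, e, hi, if_false, one_mul]
      exact integral_tilted_mul_self hw
  have hmem' : ∀ i, MemLp (fun y : Fin m → ℝ => e i * llr μ ν (y i)) 2 (Measure.pi q) := fun i =>
    (hmem i).comp_measurePreserving (measurePreserving_eval q i)
  have hT : MemLp T 2 (Measure.pi q) := memLp_finsetSum _ fun i _ => hmem' i
  have hTmean : ∫ y, T y ∂(Measure.pi q) = N * x := by
    rw [integral_finsetSum _ fun i _ => (hmem' i).integrable one_le_two, ← he, Finset.sum_mul]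
    refine Finset.sum_congr rfl fun i _ => ?_
    rw [← hmean i]
    exact integral_comp_eval (μ := q) (hmem i).aestronglyMeasurable
  have hsum : ∀ (v : ℝ) (y : Fin m → ℝ), ∑ i, e i * (v * llr μ ν (y i) - logMgf ν μ w) =
      v * T y - N * logMgf ν μ w := fun v y => by
    rw [← he, Finset.sum_mul, Finset.mul_sum, ← Finset.sum_sub_distrib]
    exact Finset.sum_congr rfl fun i _ => by ring
  have hQ₀ := pi_withDensity_exp _ q (fun i => by fun_prop) hq₀
  have hQ₁ := pi_withDensity_exp _ q (fun i => by fun_prop) hq₁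
  simp only [hsum] at hQ₀ hQ₁
  have key := eventually_half_le_exp_mul_integral_pi hT hTm
    (by rw [abs_le]; constructor <;> linarith [hw01.1, hw01.2])
    (by rw [abs_le]; constructor <;> linarith [hw01.1, hw01.2])
    hQ₀ hQ₁ f.measurable_toFun f.mem_Icc hδ
  rw [hTmean] at key
  filter_upwards [key] with k hk
  have e₀ : (N : ℝ) * rate₀ ν μ w + δ = w * (N * x) - N * logMgf ν μ w + δ := by
    rw [rate₀]; ring
  have e₁ : (N : ℝ) * rate₁ ν μ w + δ = (w - 1) * (N * x) - N * logMgf ν μ w + δ := by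
    rw [rate₁]; ring
  rw [e₀, e₁]
  exact hk

end SampleLaw

/-! ### Attacks that substitute fresh samples -/

section Attacks

lemma measurePreserving_infinitePi_fin {Ω : Type*} [MeasurableSpace Ω] (A : Measure Ω)
    [IsProbabilityMeasure A] (k : ℕ) :
    MeasurePreserving (fun (y : ℕ → Ω) (t : Fin k) => y t) (Measure.infinitePi fun _ : ℕ => A)
      (Measure.pi fun _ : Fin k => A) := by
  refine ⟨by fun_prop, ?_⟩
  have h : iIndepFun (fun (t : Fin k) (y : ℕ → Ω) => y t) (Measure.infinitePi fun _ : ℕ => A) :=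
    (iIndepFun_infinitePi (X := fun _ : ℕ => (id : Ω → Ω)) fun _ => measurable_id).precomp
      Fin.val_injective
  have hm : ∀ t : Fin k, AEMeasurable (fun y : ℕ → Ω => y t) (Measure.infinitePi fun _ : ℕ => A) :=
    fun t => (measurable_pi_apply (t : ℕ)).aemeasurable
  rw [(iIndepFun_iff_map_fun_eq_pi_map hm).1 h]
  congr 1
  ext1 t
  exact Measure.infinitePi_map_eval (fun _ : ℕ => A) t

lemma measurePreserving_pi_prod_prod {ι : Type*} [Fintype ι] {α β : Type*} [MeasurableSpace α]
    [MeasurableSpace β] {A B C : ι → Measure α} {P : ι → Measure β}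
    [∀ i, IsProbabilityMeasure (A i)] [∀ i, IsProbabilityMeasure (B i)]
    [∀ i, IsProbabilityMeasure (C i)] [∀ i, IsProbabilityMeasure (P i)]
    {φ : ι → α × α × α → β}
    (hφ : ∀ i, MeasurePreserving (φ i) ((A i).prod ((B i).prod (C i))) (P i)) :
    MeasurePreserving (fun (p : (ι → α) × (ι → α) × (ι → α)) i => φ i (p.1 i, p.2.1 i, p.2.2 i))
      ((Measure.pi A).prod ((Measure.pi B).prod (Measure.pi C))) (Measure.pi P) := by
  have h1 := (measurePreserving_arrowProdEquivProdArrow α α ι B C).symm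
  have h2 := (measurePreserving_arrowProdEquivProdArrow α (α × α) ι A
    (fun i => (B i).prod (C i))).symm
  exact (measurePreserving_pi _ P hφ).comp (h2.comp ((MeasurePreserving.id _).prod h1))

/-- Applying `φ` at each of the first `k` times to three independent i.i.d. sequences gives an
i.i.d. sample of the image law. -/
lemma measurePreserving_infinitePi_prod_prod {Ω β : Type*} [MeasurableSpace Ω] [MeasurableSpace β]
    {A B C : Measure Ω} {P : Measure β} [IsProbabilityMeasure A] [IsProbabilityMeasure B]
    [IsProbabilityMeasure C] [IsProbabilityMeasure P] {φ : Ω × Ω × Ω → β}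
    (hφ : MeasurePreserving φ (A.prod (B.prod C)) P) (k : ℕ) :
    MeasurePreserving
      (fun (p : (ℕ → Ω) × (ℕ → Ω) × (ℕ → Ω)) (t : Fin k) => φ (p.1 t, p.2.1 t, p.2.2 t))
      ((Measure.infinitePi fun _ => A).prod
        ((Measure.infinitePi fun _ => B).prod (Measure.infinitePi fun _ => C)))
      (Measure.pi fun _ => P) :=
  (measurePreserving_pi_prod_prod (ι := Fin k) fun _ => hφ).comp
    ((measurePreserving_infinitePi_fin A k).prod
      ((measurePreserving_infinitePi_fin B k).prod (measurePreserving_infinitePi_fin C k)))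

lemma eq_dirac_of_ae_eq {ρ : Measure ℝ} [IsProbabilityMeasure ρ] {a : ℝ}
    (h : ∀ᵐ b ∂ρ, a = b) : ρ = Measure.dirac a := by
  have h1 : ρ.map id = ρ.map fun _ => a := Measure.map_congr (h.mono fun b hb => hb.symm)
  rwa [Measure.map_id, Measure.map_const, measure_univ, one_smul] at h1

lemma ne_of_D₁₀_pos {ν μ : Measure ℝ} [IsProbabilityMeasure μ] (hD : 0 < D₁₀ ν μ) : ν ≠ μ := by
  rintro rfl
  rw [D₁₀, integral_congr_ae (llr_self ν)] at hD
  simp at hD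

variable {ν μ : Measure ℝ} [IsProbabilityMeasure ν] [IsProbabilityMeasure μ] {m : ℕ}

/-- Two independent samples differ with positive probability: otherwise one of the laws is a point
mass, and by mutual absolute continuity `ν` and `μ` are the same point mass. -/
lemma prod_law_diagonal_lt_one (hνμ : ν ≪ μ) (hμν : μ ≪ ν) (hne : ν ≠ μ) (θ η : Fin 2) :
    ((law ν μ θ).prod (law ν μ η)) (Set.diagonal ℝ) < 1 := by
  refine lt_of_le_of_ne prob_le_one fun h => hne ?_
  have h1 : ∀ᵐ p ∂((law ν μ θ).prod (law ν μ η)), p ∈ Set.diagonal ℝ :=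
    (mem_ae_iff_prob_eq_one measurableSet_diagonal).2 h
  obtain ⟨a, ha⟩ := (Measure.ae_ae_of_ae_prod h1).exists
  have ha' : ∀ᵐ b ∂(law ν μ η), a = b := ha
  have hν : ν ≪ law ν μ η := by
    unfold law; split_ifs
    · exact Measure.AbsolutelyContinuous.rfl
    · exact hνμ
  have hμ : μ ≪ law ν μ η := by
    unfold law; split_ifs
    · exact hμν
    · exact Measure.AbsolutelyContinuous.rfl
  rw [eq_dirac_of_ae_eq (hν.ae_le ha'), eq_dirac_of_ae_eq (hμ.ae_le ha')]

/-- The attack that replaces the measurements of each compromised sensor `i` by fresh samples of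
`law ν μ (c θ i)`. The seed holds a full array of samples of each of the two laws. -/
noncomputable def substitutionAttack (ν μ : Measure ℝ) [IsProbabilityMeasure ν]
    [IsProbabilityMeasure μ] (c : Fin 2 → Fin m → Fin 2) : AttackStrategy m where
  Seed := (ℕ → Fin m → ℝ) × (ℕ → Fin m → ℝ)
  seedLaw := (trueLaw ν μ m 0).prod (trueLaw ν μ m 1)
  isProbabilityMeasure_seedLaw := by unfold trueLaw; infer_instance
  bias I θ t y _ ξ i :=
    if h : i ∈ I then (if c θ i = 0 then ξ.1 t i else ξ.2 t i) - y (Fin.last t) ⟨i, h⟩ else 0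
  measurable_bias I θ t := by
    refine measurable_pi_lambda _ fun i => ?_
    by_cases h : i ∈ I
    · by_cases hc : c θ i = 0 <;> simp only [h, hc, dif_pos, if_true, if_false] <;> fun_prop
    · simp only [h, dif_neg, not_false_eq_true]; fun_prop

lemma biasSeq_substitutionAttack (c : Fin 2 → Fin m → Fin 2) (I : Finset (Fin m)) (θ : Fin 2)
    (y : ℕ → Fin m → ℝ) (ξ : (substitutionAttack ν μ c).Seed) (t : ℕ) (i : Fin m) :
    (substitutionAttack ν μ c).biasSeq I θ y ξ t i =
      if i ∈ I then (if c θ i = 0 then ξ.1 t i else ξ.2 t i) - y t i else 0 := by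
  rw [AttackStrategy.biasSeq]
  simp [substitutionAttack]

lemma measurePreserving_select (θ η : Fin 2) :
    MeasurePreserving (fun p : ℝ × ℝ × ℝ => (p.1, if η = 0 then p.2.1 else p.2.2))
      ((law ν μ θ).prod ((law ν μ 0).prod (law ν μ 1))) ((law ν μ θ).prod (law ν μ η)) := by
  refine (MeasurePreserving.id _).prod (g := fun q : ℝ × ℝ => if η = 0 then q.1 else q.2) ?_
  obtain rfl | rfl : η = 0 ∨ η = 1 := by revert η; decide
  · simpa using measurePreserving_fst
  · simpa using measurePreserving_snd

lemma measurePreserving_received_substitutionAttack (c : Fin 2 → Fin m → Fin 2)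
    (I : Finset (Fin m)) (θ : Fin 2) (k : ℕ) :
    MeasurePreserving
      (fun p => (substitutionAttack ν μ c).received I θ k p.1 p.2)
      ((substitutionAttack ν μ c).jointLaw ν μ θ)
      (sampleLaw ν μ (fun i => if i ∈ I then c θ i else θ) k) := by
  have hcoord : ∀ i, MeasurePreserving
      (fun p : ℝ × ℝ × ℝ => if i ∈ I then (if c θ i = 0 then p.2.1 else p.2.2) else p.1)
      ((law ν μ θ).prod ((law ν μ 0).prod (law ν μ 1)))
      (law ν μ (if i ∈ I then c θ i else θ)) := fun i => by
    by_cases hi : i ∈ I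
    · simpa [hi, Function.comp_def] using measurePreserving_snd.comp
        (measurePreserving_select (ν := ν) (μ := μ) θ (c θ i))
    · simpa [hi] using measurePreserving_fst
  have h := measurePreserving_infinitePi_prod_prod (measurePreserving_pi_prod_prod hcoord) k
  have he : (fun p : (ℕ → Fin m → ℝ) × (substitutionAttack ν μ c).Seed =>
      (substitutionAttack ν μ c).received I θ k p.1 p.2) =
      fun p t i => if i ∈ I then (if c θ i = 0 then p.2.1 t i else p.2.2 t i) else p.1 t i := by
    ext p t i
    simp only [AttackStrategy.received]
    rw [biasSeq_substitutionAttack]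
    split_ifs <;> simp
  rw [he]
  exact h

lemma measurePreserving_received_zeroAttack (I : Finset (Fin m)) (θ : Fin 2) (k : ℕ) :
    MeasurePreserving (fun p => (zeroAttack m).received I θ k p.1 p.2)
      ((zeroAttack m).jointLaw ν μ θ) (sampleLaw ν μ (fun _ => θ) k) := by
  have : IsProbabilityMeasure (trueLaw ν μ m θ) := by unfold trueLaw; infer_instance
  have h1 : MeasurePreserving Prod.fst ((trueLaw ν μ m θ).prod (zeroAttack m).seedLaw)
    (trueLaw ν μ m θ) := measurePreserving_fst
  have h := (measurePreserving_infinitePi_fin (Measure.pi fun _ : Fin m => law ν μ θ) k).comp h1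
  have he : (fun p : (ℕ → Fin m → ℝ) × (zeroAttack m).Seed =>
      (zeroAttack m).received I θ k p.1 p.2) = fun p t => p.1 t := by
    ext p t i
    simp only [AttackStrategy.received]
    rw [AttackStrategy.biasSeq]
    simp [zeroAttack]
  rw [he]
  exact h

/-- A fresh sample differs from the true measurement at some time: agreement at the first `k` times
has probability `r ^ k` with `r < 1`. -/
lemma ae_exists_substitution_ne (hνμ : ν ≪ μ) (hμν : μ ≪ ν) (hne : ν ≠ μ)
    (θ η : Fin 2) (i : Fin m) :
    ∀ᵐ p ∂((trueLaw ν μ m θ).prod ((trueLaw ν μ m 0).prod (trueLaw ν μ m 1))),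
      ∃ t : ℕ, p.1 t i ≠ if η = 0 then p.2.1 t i else p.2.2 t i := by
  have hmp : MeasurePreserving
      (fun p : (Fin m → ℝ) × (Fin m → ℝ) × (Fin m → ℝ) =>
        (p.1 i, if η = 0 then p.2.1 i else p.2.2 i))
      ((Measure.pi fun _ => law ν μ θ).prod
        ((Measure.pi fun _ => law ν μ 0).prod (Measure.pi fun _ => law ν μ 1)))
      ((law ν μ θ).prod (law ν μ η)) :=
    (measurePreserving_select θ η).comp ((measurePreserving_eval (fun _ => law ν μ θ) i).prod
      ((measurePreserving_eval (fun _ => law ν μ 0) i).prod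
        (measurePreserving_eval (fun _ => law ν μ 1) i)))
  set r := ((law ν μ θ).prod (law ν μ η)) (Set.diagonal ℝ) with hr
  have hr1 : r < 1 := prod_law_diagonal_lt_one hνμ hμν hne θ η
  rw [ae_iff]
  refine le_antisymm (ge_of_tendsto' (ENNReal.tendsto_pow_atTop_nhds_zero_of_lt_one hr1)
    fun k => ?_) zero_le
  have h := measurePreserving_infinitePi_prod_prod hmp k
  have hbox : MeasurableSet (Set.univ.pi fun _ : Fin k => Set.diagonal ℝ) :=
    MeasurableSet.univ_pi fun _ => measurableSet_diagonal
  have h2 := h.measure_preimage hbox.nullMeasurableSet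
  rw [Measure.pi_pi, Finset.prod_const, Finset.card_univ, Fintype.card_fin, ← hr] at h2
  rw [← h2]
  refine measure_mono fun p hp => ?_
  simp only [not_exists, not_not, Set.mem_ofPred_eq] at hp
  intro t _
  exact hp t

lemma admissible_substitutionAttack (hνμ : ν ≪ μ) (hμν : μ ≪ ν) (hne : ν ≠ μ)
    (c : Fin 2 → Fin m → Fin 2) (n : ℕ) :
    (substitutionAttack ν μ c).Admissible ν μ n := by
  intro I θ _
  have h : ∀ᵐ p ∂((substitutionAttack ν μ c).jointLaw ν μ θ), ∀ i : Fin m,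
      ∃ t : ℕ, p.1 t i ≠ if c θ i = 0 then p.2.1 t i else p.2.2 t i :=
    ae_all_iff.2 fun i => ae_exists_substitution_ne hνμ hμν hne θ (c θ i) i
  filter_upwards [h] with p hp
  ext i
  simp only [Set.mem_iUnion, Function.mem_support, Finset.mem_coe]
  refine ⟨fun ⟨t, ht⟩ => by_contra fun hi => ht ?_, fun hi => ?_⟩
  · rw [biasSeq_substitutionAttack, if_neg hi]
  · obtain ⟨t, ht⟩ := hp i
    refine ⟨t, ?_⟩
    rw [biasSeq_substitutionAttack, if_pos hi]
    exact sub_ne_zero.2 ht.symm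

lemma errorProb_of_measurePreserving {f : DetectionRule m} {g : AttackStrategy m} {θ : Fin 2}
    {I : Finset (Fin m)} {k : ℕ} {s : Fin m → Fin 2}
    (h : MeasurePreserving (fun p => g.received I θ k p.1 p.2) (g.jointLaw ν μ θ)
      (sampleLaw ν μ s k)) :
    errorProb ν μ f g θ I k = if θ = 0 then ∫ Y, f.toFun k Y ∂(sampleLaw ν μ s k)
      else 1 - ∫ Y, f.toFun k Y ∂(sampleLaw ν μ s k) := by
  rw [errorProb, ← h.map_eq, integral_map h.measurable.aemeasurable
    (f.measurable_toFun k).aestronglyMeasurable]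

end Attacks

/-! ### Error exponents -/

section Rates

/-- If the weights `exp (k α)` and `exp (k β)` balance the two errors and `b` decays faster than
`exp (-k β)`, then `a` decays no faster than `exp (-k α)`. -/
lemma eventually_exp_le_of_half_le {a b : ℕ → ℝ} {α β r R : ℝ}
    (hab : ∀ δ > 0, ∀ᶠ k : ℕ in atTop,
      1 / 2 ≤ Real.exp (k * (α + δ)) * a k + Real.exp (k * (β + δ)) * b k)
    (hb : ∀ᶠ k : ℕ in atTop, b k ≤ Real.exp (-(k * r))) (hr : β < r) (hR : α < R) :
    ∀ᶠ k : ℕ in atTop, Real.exp (-(k * R)) ≤ a k := by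
  obtain ⟨δ, hδ, hδr, hδR⟩ : ∃ δ > 0, β + δ < r ∧ α + δ < R :=
    ⟨min (r - β) (R - α) / 2, by have := lt_min (sub_pos.2 hr) (sub_pos.2 hR); linarith,
      by have := min_le_left (r - β) (R - α); linarith,
      by have := min_le_right (r - β) (R - α); linarith⟩
  have hlim : ∀ v > (0 : ℝ), Tendsto (fun k : ℕ => Real.exp (-((k : ℝ) * v))) atTop (𝓝 0) :=
    fun v hv => Real.tendsto_exp_neg_atTop_nhds_zero.comp
      (tendsto_natCast_atTop_atTop.atTop_mul_const hv)
  have hquarter : (0 : ℝ) < 1 / 4 := by norm_num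
  filter_upwards [hab δ hδ, hb, (hlim _ (sub_pos.2 hδr)).eventually_lt_const hquarter,
    (hlim _ (sub_pos.2 hδR)).eventually_lt_const hquarter] with k h1 h2 h3 h4
  have h5 : Real.exp (k * (β + δ)) * b k ≤ 1 / 4 := by
    calc _ ≤ Real.exp (k * (β + δ)) * Real.exp (-(k * r)) := by gcongr
      _ = Real.exp (-(k * (r - (β + δ)))) := by rw [← Real.exp_add]; congr 1; ring
      _ ≤ 1 / 4 := h3.le
  have h6 : Real.exp (k * (α + δ)) * Real.exp (-(k * R)) ≤ Real.exp (k * (α + δ)) * a k := by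
    calc _ = Real.exp (-(k * (R - (α + δ)))) := by rw [← Real.exp_add]; congr 1; ring
      _ ≤ _ := by linarith
  exact le_of_mul_le_mul_left h6 (Real.exp_pos _)

variable {ν μ : Measure ℝ} [IsProbabilityMeasure ν] [IsProbabilityMeasure μ] {m n : ℕ}
  {f : DetectionRule m} {g : AttackStrategy m}

lemma ofReal_errorProb_le_worstError (θ : Fin 2) {I : Finset (Fin m)} (hI : I.card = n) (k : ℕ) :
    ENNReal.ofReal (errorProb ν μ f g θ I k) ≤ worstError ν μ n f g k :=
  le_iSup₂ (f := fun (θ : Fin 2) (I : {I : Finset (Fin m) // I.card = n}) =>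
    ENNReal.ofReal (errorProb ν μ f g θ I k)) θ ⟨I, hI⟩

lemma rate_le_of_eventually_exp_le {θ : Fin 2} {I : Finset (Fin m)} (hI : I.card = n) {R : ℝ}
    (h : ∀ᶠ k : ℕ in atTop, Real.exp (-(k * R)) ≤ errorProb ν μ f g θ I k) :
    rate ν μ n f g ≤ R := by
  refine liminf_le_of_frequently_le' (Eventually.frequently ?_)
  filter_upwards [h, eventually_gt_atTop 0] with k hk hk0
  have hk0' : (0 : EReal) < k := by exact_mod_cast hk0
  rw [EReal.div_le_iff_le_mul hk0' (EReal.natCast_ne_top k), EReal.neg_le]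
  have h1 := ENNReal.log_monotone
    ((ENNReal.ofReal_le_ofReal hk).trans (ofReal_errorProb_le_worstError θ hI k))
  rw [ENNReal.log_ofReal_of_pos (Real.exp_pos _), Real.log_exp] at h1
  exact_mod_cast h1

lemma eventually_errorProb_le_exp_of_lt_rate {θ : Fin 2} {I : Finset (Fin m)} (hI : I.card = n)
    {r : ℝ} (h : (r : EReal) < rate ν μ n f g) :
    ∀ᶠ k : ℕ in atTop, errorProb ν μ f g θ I k ≤ Real.exp (-(k * r)) := by
  filter_upwards [eventually_lt_of_lt_liminf h, eventually_gt_atTop 0] with k hk hk0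
  have hk0' : (0 : EReal) < k := by exact_mod_cast hk0
  rw [EReal.lt_div_iff hk0' (EReal.natCast_ne_top k), EReal.lt_neg_comm] at hk
  have h1 : ENNReal.log (ENNReal.ofReal (errorProb ν μ f g θ I k)) <
      ENNReal.log (ENNReal.ofReal (Real.exp (-(k * r)))) := by
    refine (ENNReal.log_monotone (ofReal_errorProb_le_worstError θ hI k)).trans_lt ?_
    rw [ENNReal.log_ofReal_of_pos (Real.exp_pos _), Real.log_exp, mul_comm]
    exact_mod_cast hk
  rw [ENNReal.log_lt_log_iff, ENNReal.ofReal_lt_ofReal_iff (Real.exp_pos _)] at h1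
  exact h1.le

lemma rate_nonneg : 0 ≤ rate ν μ n f g := by
  refine le_liminf_of_le (h := Eventually.of_forall fun k => ?_)
  refine EReal.div_nonneg ?_ (by exact_mod_cast k.zero_le)
  rw [EReal.neg_nonneg, ENNReal.log_le_zero_iff]
  refine iSup₂_le fun θ I => ENNReal.ofReal_le_one.2 ?_
  have h0 : 0 ≤ ∫ p, f.toFun k (g.received I θ k p.1 p.2) ∂(g.jointLaw ν μ θ) :=
    integral_nonneg fun p => (f.mem_Icc k _).1
  have h1 : ∫ p, f.toFun k (g.received I θ k p.1 p.2) ∂(g.jointLaw ν μ θ) ≤ 1 := by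
    have : IsProbabilityMeasure (g.jointLaw ν μ θ) := by
      unfold AttackStrategy.jointLaw trueLaw; infer_instance
    refine (integral_mono_of_nonneg (ae_of_all _ fun p => (f.mem_Icc k _).1)
      (integrable_const (1 : ℝ)) (ae_of_all _ fun p => (f.mem_Icc k _).2)).trans ?_
    simp
  rw [errorProb]
  split_ifs <;> linarith

/-- The standing assumptions on the pair of laws, with the two conditions on the domains of the
moment generating functions combined: the domain of `M₀` is convex and is a neighbourhood of `0`
and of `1`. -/
structure RegularPair (ν μ : Measure ℝ) : Prop where
  ac_left : ν ≪ μ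
  ac_right : μ ≪ ν
  Icc_subset : Set.Icc (0 : ℝ) 1 ⊆ interior (integrableExpSet (llr μ ν) ν)
  D₁₀_pos : 0 < D₁₀ ν μ
  D₀₁_pos : 0 < D₀₁ ν μ

lemma eventually_half_le_errorProb (H : RegularPair ν μ) {w : ℝ} (hw : w ∈ Set.Icc (0 : ℝ) 1)
    {g₀ g₁ : AttackStrategy m} {J₀ J₁ : Finset (Fin m)}
    {s₀ s₁ : Fin m → Fin 2} (hs : s₀ ≤ s₁) {N : ℕ}
    (hN : (Finset.univ.filter fun i => s₀ i ≠ s₁ i).card = N)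
    (h₀ : ∀ k, MeasurePreserving (fun p => g₀.received J₀ 0 k p.1 p.2) (g₀.jointLaw ν μ 0)
      (sampleLaw ν μ s₀ k))
    (h₁ : ∀ k, MeasurePreserving (fun p => g₁.received J₁ 1 k p.1 p.2) (g₁.jointLaw ν μ 1)
      (sampleLaw ν μ s₁ k))
    {δ : ℝ} (hδ : 0 < δ) :
    ∀ᶠ k : ℕ in atTop, 1 / 2 ≤
      Real.exp (k * (N * rate₀ ν μ w + δ)) * errorProb ν μ f g₀ 0 J₀ k +
      Real.exp (k * (N * rate₁ ν μ w + δ)) * errorProb ν μ f g₁ 1 J₁ k := by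
  have := eventually_half_le_exp_mul_errors H.ac_left H.ac_right (H.Icc_subset hw) hw hs hN f hδ
  filter_upwards [this] with k hk
  rw [errorProb_of_measurePreserving (h₀ k), errorProb_of_measurePreserving (h₁ k)]
  simpa using hk

/-- Two attacks `g₀`, `g₁` that make the states `0` and `1` look like configurations differing in
only `N` sensors: if the detector resists `g₁` with exponent above `N * rate₁`, then its exponent
against `g₀` is at most `N * rate₀`. The choice `g₀ = g₁` is allowed. -/
theorem rate_le_rate₀_of_lt_rate (H : RegularPair ν μ) {w : ℝ} (hw : w ∈ Set.Icc (0 : ℝ) 1)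
    {g₀ g₁ : AttackStrategy m} {J₀ J₁ : Finset (Fin m)} (hJ₀ : J₀.card = n) (hJ₁ : J₁.card = n)
    {s₀ s₁ : Fin m → Fin 2} (hs : s₀ ≤ s₁) {N : ℕ}
    (hN : (Finset.univ.filter fun i => s₀ i ≠ s₁ i).card = N)
    (h₀ : ∀ k, MeasurePreserving (fun p => g₀.received J₀ 0 k p.1 p.2) (g₀.jointLaw ν μ 0)
      (sampleLaw ν μ s₀ k))
    (h₁ : ∀ k, MeasurePreserving (fun p => g₁.received J₁ 1 k p.1 p.2) (g₁.jointLaw ν μ 1)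
      (sampleLaw ν μ s₁ k))
    (h : ((N * rate₁ ν μ w : ℝ) : EReal) < rate ν μ n f g₁) :
    rate ν μ n f g₀ ≤ ((N * rate₀ ν μ w : ℝ) : EReal) := by
  obtain ⟨r, hr, hr'⟩ := EReal.lt_iff_exists_real_btwn.1 h
  refine EReal.le_of_forall_lt_iff_le.1 fun R hR => rate_le_of_eventually_exp_le (θ := 0) hJ₀ ?_
  exact eventually_exp_le_of_half_le
    (fun δ hδ => eventually_half_le_errorProb H hw hs hN h₀ h₁ hδ)
    (eventually_errorProb_le_exp_of_lt_rate hJ₁ hr') (EReal.coe_lt_coe_iff.1 hr)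
    (EReal.coe_lt_coe_iff.1 hR)

/-- The counterpart of `rate_le_rate₀_of_lt_rate` with the states exchanged. -/
theorem rate_le_rate₁_of_lt_rate (H : RegularPair ν μ) {w : ℝ} (hw : w ∈ Set.Icc (0 : ℝ) 1)
    {g₀ g₁ : AttackStrategy m} {J₀ J₁ : Finset (Fin m)} (hJ₀ : J₀.card = n) (hJ₁ : J₁.card = n)
    {s₀ s₁ : Fin m → Fin 2} (hs : s₀ ≤ s₁) {N : ℕ}
    (hN : (Finset.univ.filter fun i => s₀ i ≠ s₁ i).card = N)
    (h₀ : ∀ k, MeasurePreserving (fun p => g₀.received J₀ 0 k p.1 p.2) (g₀.jointLaw ν μ 0)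
      (sampleLaw ν μ s₀ k))
    (h₁ : ∀ k, MeasurePreserving (fun p => g₁.received J₁ 1 k p.1 p.2) (g₁.jointLaw ν μ 1)
      (sampleLaw ν μ s₁ k))
    (h : ((N * rate₀ ν μ w : ℝ) : EReal) < rate ν μ n f g₀) :
    rate ν μ n f g₁ ≤ ((N * rate₁ ν μ w : ℝ) : EReal) := by
  obtain ⟨r, hr, hr'⟩ := EReal.lt_iff_exists_real_btwn.1 h
  refine EReal.le_of_forall_lt_iff_le.1 fun R hR => rate_le_of_eventually_exp_le (θ := 1) hJ₁ ?_
  refine eventually_exp_le_of_half_le (fun δ hδ => ?_)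
    (eventually_errorProb_le_exp_of_lt_rate (θ := 0) hJ₀ hr') (EReal.coe_lt_coe_iff.1 hr)
    (EReal.coe_lt_coe_iff.1 hR)
  filter_upwards [eventually_half_le_errorProb (f := f) H hw hs hN h₀ h₁ hδ] with k hk
  linarith

/-- At the tilt where `rate₀ = rate₁`, exceeding this common value is self-contradictory. -/
lemma rate_zeroAttack_le (H : RegularPair ν μ) (hn : n ≤ m) {w : ℝ} (hw : w ∈ Set.Icc (0 : ℝ) 1)
    (heq : rate₁ ν μ w = rate₀ ν μ w) :
    rate ν μ n f (zeroAttack m) ≤ ((m * rate₀ ν μ w : ℝ) : EReal) := by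
  obtain ⟨I, -, hI⟩ := Finset.exists_subset_card_eq (s := (Finset.univ : Finset (Fin m))) (n := n)
    (by simpa using hn)
  refine le_of_not_gt fun h => absurd h (not_lt.2 ?_)
  exact rate_le_rate₀_of_lt_rate H hw (s₀ := fun _ => 0) (s₁ := fun _ => 1) hI hI
    (fun _ => zero_le_one) (by simp) (fun k => measurePreserving_received_zeroAttack I 0 k)
    (fun k => measurePreserving_received_zeroAttack I 1 k) (heq ▸ h)

lemma security_le_rate_substitutionAttack (H : RegularPair ν μ) (c : Fin 2 → Fin m → Fin 2) :
    security ν μ n f ≤ rate ν μ n f (substitutionAttack ν μ c) :=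
  iInf₂_le (substitutionAttack ν μ c)
    (admissible_substitutionAttack H.ac_left H.ac_right (ne_of_D₁₀_pos H.D₁₀_pos) c n)

/-- Two sets of `n` sensors that together cover as many sensors as possible. -/
lemma exists_card_compl_union {m n : ℕ} (hn : n ≤ m) :
    ∃ J₀ J₁ : Finset (Fin m), J₀.card = n ∧ J₁.card = n ∧ (J₀ ∪ J₁)ᶜ.card = m - 2 * n := by
  obtain ⟨J₀, -, hJ₀⟩ := Finset.exists_subset_card_eq (s := (Finset.univ : Finset (Fin m)))
    (n := n) (by simpa using hn)
  have hc : J₀ᶜ.card = m - n := by rw [Finset.card_compl, Fintype.card_fin, hJ₀]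
  rcases le_total n (m - n) with h | h
  · obtain ⟨J₁, hsub, hJ₁⟩ := Finset.exists_subset_card_eq (h.trans_eq hc.symm)
    refine ⟨J₀, J₁, hJ₀, hJ₁, ?_⟩
    rw [Finset.card_compl, Fintype.card_fin,
      Finset.card_union_of_disjoint (disjoint_compl_right.mono_right hsub), hJ₀, hJ₁]
    omega
  · obtain ⟨J₁, hsub, hJ₁⟩ := Finset.exists_superset_card_eq (hc.trans_le h)
      (by simpa using hn)
    refine ⟨J₀, J₁, hJ₀, hJ₁, ?_⟩
    have : J₀ ∪ J₁ = Finset.univ := by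
      ext i
      by_cases hi : i ∈ J₀
      · simp [hi]
      · simp [hsub (Finset.mem_compl.2 hi)]
    rw [this, Finset.compl_univ, Finset.card_empty]
    omega

/-- The sensors of `J₀`, compromised in state `0`, and those of `J₁`, compromised in state `1`, are
made to report the same law in both states, so that only the sensors outside `J₀ ∪ J₁`
distinguish the states. -/
lemma security_le_of_disguise (H : RegularPair ν μ) (hn : n ≤ m) {w : ℝ}
    (hw : w ∈ Set.Icc (0 : ℝ) 1) (heq : rate₁ ν μ w = rate₀ ν μ w) :
    security ν μ n f ≤ (((m - 2 * n : ℕ) * rate₀ ν μ w : ℝ) : EReal) := by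
  obtain ⟨J₀, J₁, hJ₀, hJ₁, hJ⟩ := exists_card_compl_union hn
  -- Sensors in `J₁` report `ν` and those in `J₀ \ J₁` report `μ`, whatever the state.
  let c : Fin 2 → Fin m → Fin 2 := fun θ i => if θ = 0 ∧ i ∉ J₁ then 1 else 0
  refine (security_le_rate_substitutionAttack H c).trans
    (le_of_not_gt fun h => absurd h (not_lt.2 ?_))
  refine rate_le_rate₀_of_lt_rate H hw hJ₀ hJ₁ ?_ ?_
    (fun k => measurePreserving_received_substitutionAttack c J₀ 0 k)
    (fun k => measurePreserving_received_substitutionAttack c J₁ 1 k) (heq ▸ h)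
  · intro i
    by_cases h0 : i ∈ J₀ <;> by_cases h1 : i ∈ J₁ <;> simp [c, h0, h1]
  · rw [← hJ]
    congr 1
    ext i
    by_cases h0 : i ∈ J₀ <;> by_cases h1 : i ∈ J₁ <;> simp [c, h0, h1]

/-- Replacing the measurements by fresh samples of their own law is admissible and does not change
the law of what the detector receives. -/
lemma security_le_efficiency (H : RegularPair ν μ) :
    security ν μ n f ≤ efficiency ν μ n f := by
  refine (security_le_rate_substitutionAttack H fun θ _ => θ).trans (le_of_eq ?_)
  have : ∀ (θ : Fin 2) (I : Finset (Fin m)) (k : ℕ),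
      errorProb ν μ f (substitutionAttack ν μ fun θ _ => θ) θ I k =
        errorProb ν μ f (zeroAttack m) θ I k := fun θ I k => by
    rw [errorProb_of_measurePreserving (measurePreserving_received_zeroAttack I θ k),
      errorProb_of_measurePreserving (measurePreserving_received_substitutionAttack _ I θ k)]
    simp
  simp only [efficiency, rate, worstError, this]

/-- Compromised sensors report `μ` in both states: state `1` then looks unattacked, where the
efficiency controls the error, and state `0` differs from it in `m - n` sensors only. -/
lemma security_le_rate₀ (H : RegularPair ν μ) (hn : n ≤ m) {w : ℝ} (hw : w ∈ Set.Icc (0 : ℝ) 1)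
    (h : (((m - n : ℕ) * rate₁ ν μ w : ℝ) : EReal) < efficiency ν μ n f) :
    security ν μ n f ≤ (((m - n : ℕ) * rate₀ ν μ w : ℝ) : EReal) := by
  obtain ⟨I, -, hI⟩ := Finset.exists_subset_card_eq (s := (Finset.univ : Finset (Fin m))) (n := n)
    (by simpa using hn)
  refine (security_le_rate_substitutionAttack H fun _ _ => 1).trans ?_
  refine rate_le_rate₀_of_lt_rate H hw hI hI ?_ ?_
    (fun k => measurePreserving_received_substitutionAttack _ I 0 k)
    (fun k => measurePreserving_received_zeroAttack I 1 k) h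
  · intro i
    by_cases hi : i ∈ I <;> simp [hi]
  · have : (Finset.univ.filter fun i => (if i ∈ I then (1 : Fin 2) else 0) ≠ 1) = Iᶜ := by
      ext i; by_cases hi : i ∈ I <;> simp [hi]
    rw [this, Finset.card_compl, Fintype.card_fin, hI]

/-- Compromised sensors report `ν` in both states; the counterpart of `security_le_rate₀`. -/
lemma security_le_rate₁ (H : RegularPair ν μ) (hn : n ≤ m) {w : ℝ} (hw : w ∈ Set.Icc (0 : ℝ) 1)
    (h : (((m - n : ℕ) * rate₀ ν μ w : ℝ) : EReal) < efficiency ν μ n f) :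
    security ν μ n f ≤ (((m - n : ℕ) * rate₁ ν μ w : ℝ) : EReal) := by
  obtain ⟨I, -, hI⟩ := Finset.exists_subset_card_eq (s := (Finset.univ : Finset (Fin m))) (n := n)
    (by simpa using hn)
  refine (security_le_rate_substitutionAttack H fun _ _ => 0).trans ?_
  refine rate_le_rate₁_of_lt_rate H hw hI hI ?_ ?_
    (fun k => measurePreserving_received_zeroAttack I 0 k)
    (fun k => measurePreserving_received_substitutionAttack _ I 1 k) h
  · intro i
    by_cases hi : i ∈ I <;> simp [hi]
  · have : (Finset.univ.filter fun i => (0 : Fin 2) ≠ if i ∈ I then 0 else 1) = Iᶜ := by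
      ext i; by_cases hi : i ∈ I <;> simp [hi]
    rw [this, Finset.card_compl, Fintype.card_fin, hI]

end Rates

/-! ### Parametrization of the trade-off curve by the tilt -/

section Curve

/-- The last time at which `J` is at least `ζ`. Taking the last one makes `J < ζ` strict afterwards
without any monotonicity of `J`. -/
lemma exists_last_eq {J : ℝ → ℝ} (hJ : ContinuousOn J (Set.Icc 0 1)) {ζ : ℝ} (h0 : ζ ≤ J 0)
    (h1 : J 1 < ζ) : ∃ w ∈ Set.Ico (0 : ℝ) 1, J w = ζ ∧ ∀ v ∈ Set.Ioo w 1, J v < ζ := by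
  have hcomp : IsCompact (Set.Icc (0 : ℝ) 1 ∩ J ⁻¹' Set.Ici ζ) :=
    isCompact_Icc.of_isClosed_subset (hJ.preimage_isClosed_of_isClosed isClosed_Icc isClosed_Ici)
      Set.inter_subset_left
  obtain ⟨w, ⟨hw, hwζ⟩, hmax⟩ := hcomp.exists_isGreatest ⟨0, ⟨le_rfl, zero_le_one⟩, h0⟩
  have hw1 : w ≠ 1 := by rintro rfl; exact absurd hwζ (not_le.2 h1)
  refine ⟨w, ⟨hw.1, lt_of_le_of_ne hw.2 hw1⟩, ?_, fun v hv => lt_of_not_ge fun hge =>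
    absurd (hmax ⟨⟨hw.1.trans hv.1.le, hv.2.le⟩, hge⟩) (not_le.2 hv.1)⟩
  obtain ⟨v, hv, hvζ⟩ := intermediate_value_Icc' hw.2 (hJ.mono (Set.Icc_subset_Icc_left hw.1))
    ⟨h1.le, hwζ⟩
  have : v ≤ w := hmax ⟨⟨hw.1.trans hv.1, hv.2⟩, hvζ.ge⟩
  rwa [le_antisymm hv.1 this]

lemma exists_first_eq {J : ℝ → ℝ} (hJ : ContinuousOn J (Set.Icc 0 1)) {ζ : ℝ} (h0 : J 0 < ζ)
    (h1 : ζ ≤ J 1) : ∃ w ∈ Set.Ioc (0 : ℝ) 1, J w = ζ ∧ ∀ v ∈ Set.Ioo 0 w, J v < ζ := by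
  have hJ' : ContinuousOn (fun v => J (1 - v)) (Set.Icc 0 1) :=
    hJ.comp (by fun_prop) fun v hv => ⟨sub_nonneg.2 hv.2, sub_le_self _ hv.1⟩
  obtain ⟨w, hw, hwζ, hlt⟩ := exists_last_eq hJ' (by simpa using h1) (by simpa using h0)
  refine ⟨1 - w, ⟨by linarith [hw.2], by linarith [hw.1]⟩, hwζ, fun v hv => ?_⟩
  simpa using hlt (1 - v) ⟨by linarith [hv.2], by linarith [hv.1]⟩

variable {ν μ : Measure ℝ} [IsProbabilityMeasure ν]

lemma rate₀_zero : rate₀ ν μ 0 = 0 := by simp [rate₀, logMgf_zero]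

lemma rate₁_zero (H : RegularPair ν μ) : rate₁ ν μ 0 = D₀₁ ν μ := by
  simp [rate₁, logMgf_zero, deriv_logMgf_zero (H.Icc_subset ⟨le_rfl, zero_le_one⟩)]

/-- To the right of `Λ' w`, the function `I₀` lies above an affine function of slope `w > 0` that
already takes the value `ζ` at `Λ' w`. -/
lemma isGreatest_I₀_level (H : RegularPair ν μ) {w ζ : ℝ} (hw : w ∈ Set.Ioc (0 : ℝ) 1)
    (hζ : rate₀ ν μ w = ζ) :
    IsGreatest {x : ℝ | I₀ ν μ x = (ζ : EReal)} (deriv (logMgf ν μ) w) := by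
  have hw' := H.Icc_subset (Set.Ioc_subset_Icc_self hw)
  refine ⟨(I₀_deriv hw').trans (by rw [hζ]), fun x hx => ?_⟩
  have h := (le_I₀ (interior_subset hw') x).trans_eq hx
  rw [EReal.coe_le_coe_iff, ← hζ, rate₀] at h
  exact le_of_mul_le_mul_right (by linarith) hw.1

/-- Strict monotonicity of `rate₁` is not used to conclude `w = 0`: if `rate₁ w = D(0‖1)`, the
tangent to `Λ` at `0` forces `Λ' w ≤ -D(0‖1)`, hence `rate₀ w = rate₁ w + Λ' w ≤ 0`. -/
lemma rate₀_nonpos_of_rate₁_eq (H : RegularPair ν μ) {w : ℝ} (hw : w ∈ Set.Ico (0 : ℝ) 1)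
    (h : rate₁ ν μ w = D₀₁ ν μ) : rate₀ ν μ w ≤ 0 := by
  have h0 := H.Icc_subset ⟨le_rfl, zero_le_one⟩
  have ht := logMgf_tangent_real h0
    (interior_subset (H.Icc_subset (Set.Ico_subset_Icc_self hw)))
  rw [logMgf_zero, deriv_logMgf_zero h0] at ht
  have hx : deriv (logMgf ν μ) w ≤ -D₀₁ ν μ := by
    rw [rate₁] at h
    exact le_of_mul_le_mul_left (a := 1 - w) (by linarith) (by linarith [hw.2])
  rw [rate₁] at h
  rw [rate₀]
  linarith

variable [IsProbabilityMeasure μ]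

lemma rate₁_one (H : RegularPair ν μ) : rate₁ ν μ 1 = 0 := by
  simp [rate₁, logMgf_one H.ac_left H.ac_right]

lemma rate₀_one (H : RegularPair ν μ) : rate₀ ν μ 1 = D₁₀ ν μ := by
  simp [rate₀, logMgf_one H.ac_left H.ac_right,
    deriv_logMgf_one H.ac_left H.ac_right (H.Icc_subset ⟨zero_le_one, le_rfl⟩)]

/-- `I₀ 0` is attained at a tilt with `Λ' w = 0`, where `rate₀` and `rate₁` agree. -/
lemma exists_chernoff (H : RegularPair ν μ) : ∃ w ∈ Set.Icc (0 : ℝ) 1,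
    rate₁ ν μ w = rate₀ ν μ w ∧ chernoff ν μ = (rate₀ ν μ w : EReal) := by
  obtain ⟨w, hw, hw0⟩ := intermediate_value_Icc zero_le_one
    (continuousOn_deriv_logMgf.mono H.Icc_subset)
    (show (0 : ℝ) ∈ Set.Icc (deriv (logMgf ν μ) 0) (deriv (logMgf ν μ) 1) by
      rw [deriv_logMgf_zero (H.Icc_subset ⟨le_rfl, zero_le_one⟩),
        deriv_logMgf_one H.ac_left H.ac_right (H.Icc_subset ⟨zero_le_one, le_rfl⟩)]
      exact ⟨by linarith [H.D₀₁_pos], H.D₁₀_pos.le⟩)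
  refine ⟨w, hw, by simp [rate₀, rate₁, hw0], ?_⟩
  rw [chernoff, ← I₀_deriv (H.Icc_subset hw), hw0]

/-- To the left of `Λ' w`, the function `I₁` lies above an affine function of slope `w - 1 < 0`
that already takes the value `ζ` at `Λ' w`. -/
lemma isLeast_I₁_level (H : RegularPair ν μ) {w ζ : ℝ} (hw : w ∈ Set.Ico (0 : ℝ) 1)
    (hζ : rate₁ ν μ w = ζ) :
    IsLeast {x : ℝ | I₁ ν μ x = (ζ : EReal)} (deriv (logMgf ν μ) w) := by
  have hw' := H.Icc_subset (Set.Ico_subset_Icc_self hw)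
  refine ⟨(I₁_deriv H.ac_left H.ac_right hw').trans (by rw [hζ]), fun x hx => ?_⟩
  have h := (le_I₁ H.ac_left H.ac_right (interior_subset hw') x).trans_eq hx
  rw [EReal.coe_le_coe_iff, ← hζ, rate₁] at h
  exact le_of_mul_le_mul_right (a := 1 - w) (by linarith) (by linarith [hw.2])

/-- The counterpart of `rate₀_nonpos_of_rate₁_eq`, from the tangent to `Λ` at `1`. -/
lemma rate₁_nonpos_of_rate₀_eq (H : RegularPair ν μ) {w : ℝ} (hw : w ∈ Set.Ioc (0 : ℝ) 1)
    (h : rate₀ ν μ w = D₁₀ ν μ) : rate₁ ν μ w ≤ 0 := by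
  have h1 := H.Icc_subset ⟨zero_le_one, le_rfl⟩
  have ht := logMgf_tangent_real h1
    (interior_subset (H.Icc_subset (Set.Ioc_subset_Icc_self hw)))
  rw [logMgf_one H.ac_left H.ac_right, deriv_logMgf_one H.ac_left H.ac_right h1] at ht
  rw [rate₀] at h
  have hx : D₁₀ ν μ ≤ deriv (logMgf ν μ) w :=
    le_of_mul_le_mul_left (a := w) (by linarith) hw.1
  rw [rate₁]
  linarith

variable {m n : ℕ} {f : DetectionRule m}

/-- Tilts slightly larger than `w` satisfy `rate₁ < ζ` strictly, so `security_le_rate₀` applies to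
them, and the bound passes to the limit. -/
lemma exists_rate₁_eq_security_le (H : RegularPair ν μ) (hn : n < m) {ζ : ℝ} (hζ : 0 < ζ)
    (hζ' : ζ ≤ D₀₁ ν μ) (hE : (((m - n : ℕ) * ζ : ℝ) : EReal) ≤ efficiency ν μ n f) :
    ∃ w ∈ Set.Ico (0 : ℝ) 1, rate₁ ν μ w = ζ ∧
      security ν μ n f ≤ (((m - n : ℕ) * rate₀ ν μ w : ℝ) : EReal) := by
  have hpos : (0 : ℝ) < (m - n : ℕ) := by exact_mod_cast Nat.sub_pos_of_lt hn
  obtain ⟨w, hw, hwζ, hlt⟩ := exists_last_eq (continuousOn_rate₁.mono H.Icc_subset)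
    (hζ'.trans_eq (rate₁_zero H).symm) ((rate₁_one H).trans_lt hζ)
  refine ⟨w, hw, hwζ, ?_⟩
  have hcont : ContinuousAt (rate₀ ν μ) w := continuousOn_rate₀.continuousAt
    (isOpen_interior.mem_nhds (H.Icc_subset (Set.Ico_subset_Icc_self hw)))
  have hlim : Tendsto (fun v => (((m - n : ℕ) * rate₀ ν μ v : ℝ) : EReal)) (𝓝[>] w)
      (𝓝 (((m - n : ℕ) * rate₀ ν μ w : ℝ) : EReal)) :=
    (continuous_coe_real_ereal.tendsto _).comp
      ((hcont.tendsto.mono_left nhdsWithin_le_nhds).const_mul _)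
  refine ge_of_tendsto hlim ?_
  filter_upwards [Ioo_mem_nhdsGT hw.2] with v hv
  refine security_le_rate₀ H hn.le ⟨hw.1.trans hv.1.le, hv.2.le⟩ (lt_of_lt_of_le ?_ hE)
  exact EReal.coe_lt_coe_iff.2 (mul_lt_mul_of_pos_left (hlt v hv) hpos)

/-- The counterpart of `exists_rate₁_eq_security_le`, approaching `w` from below. -/
lemma exists_rate₀_eq_security_le (H : RegularPair ν μ) (hn : n < m) {ζ : ℝ} (hζ : 0 < ζ)
    (hζ' : ζ ≤ D₁₀ ν μ) (hE : (((m - n : ℕ) * ζ : ℝ) : EReal) ≤ efficiency ν μ n f) :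
    ∃ w ∈ Set.Ioc (0 : ℝ) 1, rate₀ ν μ w = ζ ∧
      security ν μ n f ≤ (((m - n : ℕ) * rate₁ ν μ w : ℝ) : EReal) := by
  have hpos : (0 : ℝ) < (m - n : ℕ) := by exact_mod_cast Nat.sub_pos_of_lt hn
  obtain ⟨w, hw, hwζ, hlt⟩ := exists_first_eq (continuousOn_rate₀.mono H.Icc_subset)
    (rate₀_zero.trans_lt hζ) (hζ'.trans_eq (rate₀_one H).symm)
  refine ⟨w, hw, hwζ, ?_⟩
  have hcont : ContinuousAt (rate₁ ν μ) w := continuousOn_rate₁.continuousAt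
    (isOpen_interior.mem_nhds (H.Icc_subset (Set.Ioc_subset_Icc_self hw)))
  have hlim : Tendsto (fun v => (((m - n : ℕ) * rate₁ ν μ v : ℝ) : EReal)) (𝓝[<] w)
      (𝓝 (((m - n : ℕ) * rate₁ ν μ w : ℝ) : EReal)) :=
    (continuous_coe_real_ereal.tendsto _).comp
      ((hcont.tendsto.mono_left nhdsWithin_le_nhds).const_mul _)
  refine ge_of_tendsto hlim ?_
  filter_upwards [Ioo_mem_nhdsLT hw.1] with v hv
  refine security_le_rate₁ H hn.le ⟨hv.1.le, hv.2.le.trans hw.2⟩ (lt_of_lt_of_le ?_ hE)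
  exact EReal.coe_lt_coe_iff.2 (mul_lt_mul_of_pos_left (hlt v hv) hpos)

lemma security_nonneg : 0 ≤ security ν μ n f := le_iInf₂ fun _ _ => rate_nonneg

lemma security_nonpos_of_le_efficiency (H : RegularPair ν μ) (hn : n < m)
    (hE : (((m - n : ℕ) * Dmin ν μ : ℝ) : EReal) ≤ efficiency ν μ n f) :
    security ν μ n f ≤ 0 := by
  have hpos : (0 : ℝ) ≤ (m - n : ℕ) := Nat.cast_nonneg _
  rw [Dmin] at hE
  rcases min_choice (D₀₁ ν μ) (D₁₀ ν μ) with h | h <;> rw [h] at hE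
  · obtain ⟨w, hw, hw', hS⟩ := exists_rate₁_eq_security_le H hn H.D₀₁_pos le_rfl hE
    refine hS.trans (EReal.coe_nonpos.2 ?_)
    exact mul_nonpos_of_nonneg_of_nonpos hpos (rate₀_nonpos_of_rate₁_eq H hw hw')
  · obtain ⟨w, hw, hw', hS⟩ := exists_rate₀_eq_security_le H hn H.D₁₀_pos le_rfl hE
    refine hS.trans (EReal.coe_nonpos.2 ?_)
    exact mul_nonpos_of_nonneg_of_nonpos hpos (rate₁_nonpos_of_rate₀_eq H hw hw')

lemma security_le_tradeoff (H : RegularPair ν μ) (hn : n < m) {z : ℝ} (hz : 0 < z)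
    (hz' : z < ((m : ℝ) - n) * Dmin ν μ) (hE : efficiency ν μ n f = (z : EReal)) :
    IsGreatest {x : ℝ | I₀ ν μ x = ((z / ((m : ℝ) - (n : ℝ)) : ℝ) : EReal)}
      (I₀inv ν μ (z / ((m : ℝ) - (n : ℝ)))) ∧
    IsLeast {x : ℝ | I₁ ν μ x = ((z / ((m : ℝ) - (n : ℝ)) : ℝ) : EReal)}
      (I₁inv ν μ (z / ((m : ℝ) - (n : ℝ)))) ∧
    security ν μ n f ≤ tradeoff ν μ m n z := by
  rw [tradeoff]
  have hcast : (m : ℝ) - n = (m - n : ℕ) := (Nat.cast_sub hn.le).symm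
  rw [hcast] at hz' ⊢
  have hpos : (0 : ℝ) < (m - n : ℕ) := by exact_mod_cast Nat.sub_pos_of_lt hn
  set ζ := z / ((m - n : ℕ) : ℝ) with hζ
  have hζ0 : 0 < ζ := div_pos hz hpos
  have hζD : ζ < Dmin ν μ := by rwa [hζ, div_lt_iff₀' hpos]
  have hE' : (((m - n : ℕ) * ζ : ℝ) : EReal) ≤ efficiency ν μ n f := by
    rw [hE, hζ, mul_div_cancel₀ _ hpos.ne']
  obtain ⟨w₁, hw₁, h₁, hS₁⟩ := exists_rate₁_eq_security_le H hn hζ0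
    (hζD.le.trans (min_le_left _ _)) hE'
  obtain ⟨w₀, hw₀, h₀, hS₀⟩ := exists_rate₀_eq_security_le H hn hζ0
    (hζD.le.trans (min_le_right _ _)) hE'
  have hG := isGreatest_I₀_level H hw₀ h₀
  have hL := isLeast_I₁_level H hw₁ h₁
  rw [I₀inv, I₁inv, hG.csSup_eq, hL.csInf_eq, I₀_deriv (H.Icc_subset (Set.Ico_subset_Icc_self hw₁)),
    I₁_deriv H.ac_left H.ac_right (H.Icc_subset (Set.Ioc_subset_Icc_self hw₀))]
  refine ⟨hG, hL, ?_⟩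
  rcases min_choice ((rate₀ ν μ w₁ : ℝ) : EReal) ((rate₁ ν μ w₀ : ℝ) : EReal) with h | h <;>
    rw [h, ← EReal.coe_mul]
  exacts [hS₁, hS₀]

end Curve
end ByzantineDetection

theorem theorem3 (ν μ : Measure ℝ) [IsProbabilityMeasure ν] [IsProbabilityMeasure μ]
    (hνμ : ν ≪ μ) (hμν : μ ≪ ν)
    (hdom₀ : (0 : ℝ) ∈ interior (dom₀ ν μ)) (hdom₁ : (0 : ℝ) ∈ interior (dom₁ ν μ))
    (hD₁₀ : 0 < D₁₀ ν μ) (hD₀₁ : 0 < D₀₁ ν μ)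
    (m n : ℕ) (hnm : n ≤ m) (f : DetectionRule m) :
    efficiency ν μ n f ≤ (m : EReal) * chernoff ν μ ∧
    security ν μ n f ≤ ((max 0 ((m : ℝ) - 2 * (n : ℝ)) : ℝ) : EReal) * chernoff ν μ ∧
    security ν μ n f ≤ efficiency ν μ n f ∧
    ∀ z : ℝ, efficiency ν μ n f = (z : EReal) →
      (0 < z → z < ((m : ℝ) - (n : ℝ)) * Dmin ν μ →
        -- the maximum and the minimum in the definition of `tradeoff` exist
        IsGreatest {x : ℝ | I₀ ν μ x = ((z / ((m : ℝ) - (n : ℝ)) : ℝ) : EReal)}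
          (I₀inv ν μ (z / ((m : ℝ) - (n : ℝ)))) ∧
        IsLeast {x : ℝ | I₁ ν μ x = ((z / ((m : ℝ) - (n : ℝ)) : ℝ) : EReal)}
          (I₁inv ν μ (z / ((m : ℝ) - (n : ℝ)))) ∧
        security ν μ n f ≤ tradeoff ν μ m n z) ∧
      (((m : ℝ) - (n : ℝ)) * Dmin ν μ ≤ z → security ν μ n f = 0) := by
  have H : RegularPair ν μ := ⟨hνμ, hμν,
    Icc_subset_interior_integrableExpSet hνμ hμν hdom₀ hdom₁, hD₁₀, hD₀₁⟩
  obtain ⟨w, hw, heq, hC⟩ := exists_chernoff H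
  have hS := security_le_of_disguise (f := f) H hnm hw heq
  refine ⟨?_, ?_, security_le_efficiency H, fun z hz => ⟨fun hz0 hzD => ?_, fun hzD => ?_⟩⟩
  · rw [hC]
    exact_mod_cast rate_zeroAttack_le H hnm hw heq
  · have hcast : max 0 ((m : ℝ) - 2 * n) = (m - 2 * n : ℕ) := by
      rcases le_total (2 * n) m with h | h
      · rw [Nat.cast_sub h, max_eq_right] <;> push_cast
        · rfl
        · exact sub_nonneg.2 (by exact_mod_cast h)
      · rw [Nat.sub_eq_zero_of_le h, Nat.cast_zero, max_eq_left]
        exact sub_nonpos.2 (by exact_mod_cast h)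
    rw [hC, hcast, ← EReal.coe_mul]
    exact hS
  · refine security_le_tradeoff H (lt_of_le_of_ne hnm ?_) hz0 hzD hz
    rintro rfl
    simp at hzD
    linarith
  · refine le_antisymm ?_ security_nonneg
    rcases hnm.eq_or_lt with rfl | hlt
    · simpa [Nat.sub_eq_zero_of_le (show n ≤ 2 * n by omega)] using hS
    · refine security_nonpos_of_le_efficiency H hlt ?_
      rw [hz, Nat.cast_sub hnm]
      exact EReal.coe_le_coe_iff.2 hzD
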